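/- Let $N$ be a natural number and let $\mathrm{d}U$ be Haar measure of total mass one on the unitary group $\mathrm{U}(N)$. For a Young diagram $\lambda$ with $d$ cells (written $\lambda\vdash d$) and $\ell(\lambda)$ rows, let $\mathsf V^\lambda$ be the corresponding irreducible complex representation of the symmetric group $\mathrm{S}(d)$, with character $\chi^\lambda$, and, when $\ell(\lambda)\le N$, let $\mathsf W^\lambda$ be the corresponding irreducible polynomial representation of $\mathrm{GL}_N(\mathbb C)$. Let $$s_\lambda(x_1,\dots,x_N)=\frac1{d!}\sum_{\pi\in \mathrm S(d)}\chi^\lambda(\pi)\,p_{\pi}(x_1,\dots,x_N),\qquad p_\pi(x_1,\dots,x_N)=\prod_{\text{cycles } \gamma \text{ of }\pi}\ \sum_{j=1}^N x_j^{|\gamma|},$$ be the Schur polynomial, where fixed points of $\pi$ count as cycles of length $1$. Then for all $z\in\mathbb C$ and $A,B\in\mathrm{Mat}_N(\mathbb C)$, $$\int_{\mathrm U(N)} e^{zN\operatorname{Tr}AUBU^{-1}}\,\mathrm dU = 1+\sum_{d=1}^\infty \frac{z^d}{d!}N^d\sum_{\substack{\lambda\vdash d\\ \ell(\lambda)\le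 N}} s_\lambda(a_1,\dots,a_N)\,s_\lambda(b_1,\dots,b_N)\,\frac{\dim\mathsf V^\lambda}{\dim\mathsf W^\lambda},$$ $$\int_{\mathrm U(N)} e^{zN\operatorname{Tr}(AU+BU^{-1})}\,\mathrm dU = 1+\sum_{d=1}^\infty \frac{z^{2d}}{d!\,d!}N^{2d}\sum_{\substack{\lambda\vdash d\\ \ell(\lambda)\le N}} s_\lambda(c_1,\dots,c_N)\,\frac{(\dim\mathsf V^\lambda)^2}{\dim\mathsf W^\lambda},$$ where $a_1,\dots,a_N$, $b_1,\dots,b_N$ and $c_1,\dots,c_N$ are the eigenvalues, with algebraic multiplicity, of $A$, $B$ and $AB$ respectively. As series of functions of $(z,a_1,\dots,a_N,b_1,\dots,b_N)\in\mathbb C^{2N+1}$ and of $(z,c_1,\dots,c_N)\in\mathbb C^{N+1}$ respectively, they converge absolutely, and uniformly on compact subsets; this holds both for the series indexed by $d$ and, with the inner sums expanded, for the series indexed by all Young diagrams $\lambda$ with $\ell(\lambda)\le N$, for which the series of absolute values also converges uniformly on compact subsets. -/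

import Mathlib

open scoped TensorProduct

noncomputable section

namespace CharExp

/-! ### Young diagrams and irreducible representations of the symmetric groups -/

/-- The number of rows of a Young diagram. -/
def numRows (lam : YoungDiagram) : ℕ := lam.colLen 0

theorem finite_diagrams (N d : ℕ) :
    {lam : YoungDiagram | lam.card = d ∧ numRows lam ≤ N}.Finite := by
  have hinj : Function.Injective (YoungDiagram.cells) := fun a b h => YoungDiagram.ext h
  refine Set.Finite.subset (Set.Finite.preimage hinj.injOn
    ((Finset.range d ×ˢ Finset.range d).powerset.finite_toSet)) ?_
  rintro lam ⟨hd, -⟩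
  simp only [Set.mem_preimage, Finset.mem_coe, Finset.mem_powerset]
  rintro ⟨i, j⟩ hij
  have hij' : (i, j) ∈ lam := hij
  have h1 : lam.colLen j ≤ d := by
    rw [lam.colLen_eq_card, ← hd]
    exact Finset.card_le_card (Finset.filter_subset _ _)
  have h2 : lam.rowLen i ≤ d := by
    rw [lam.rowLen_eq_card, ← hd]
    exact Finset.card_le_card (Finset.filter_subset _ _)
  simp only [Finset.mem_product, Finset.mem_range]
  exact ⟨(YoungDiagram.mem_iff_lt_colLen.1 hij').trans_le h1,
    (YoungDiagram.mem_iff_lt_rowLen.1 hij').trans_le h2⟩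

/-- The finite set of Young diagrams with `d` cells and at most `N` rows. -/
def diagrams (N d : ℕ) : Finset YoungDiagram := (finite_diagrams N d).toFinset

/-- Permutations preserving every row of the numbering `t` of the cells of `lam`. -/
def rowPerms {d : ℕ} {lam : YoungDiagram} (t : lam.cells ≃ Fin d) :
    Finset (Equiv.Perm (Fin d)) :=
  Finset.univ.filter fun g => ∀ k, (t.symm (g k)).1.1 = (t.symm k).1.1

/-- Permutations preserving every column of the numbering `t` of the cells of `lam`. -/
def colPerms {d : ℕ} {lam : YoungDiagram} (t : lam.cells ≃ Fin d) :
    Finset (Equiv.Perm (Fin d)) :=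
  Finset.univ.filter fun g => ∀ k, (t.symm (g k)).1.2 = (t.symm k).1.2

/-- The Young symmetrizer of the numbering `t`: the sum of the row permutations times the signed
sum of the column permutations. -/
def youngSymmetrizer {d : ℕ} {lam : YoungDiagram} (t : lam.cells ≃ Fin d) :
    MonoidAlgebra ℂ (Equiv.Perm (Fin d)) :=
  (∑ g ∈ rowPerms t, MonoidAlgebra.single g 1) *
    ∑ g ∈ colPerms t, MonoidAlgebra.single g ((Equiv.Perm.sign g : ℤ) : ℂ)

/-- A numbering of the cells of `lam`. The representations below do not depend, up to isomorphism,
on which numbering is taken. -/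
def numbering (lam : YoungDiagram) : lam.cells ≃ Fin lam.card := lam.cells.equivFin

/-- The irreducible `S(d)`-module `V^lam` (`d` the number of cells of `lam`): the left ideal of the
group algebra generated by the Young symmetrizer. -/
def V (lam : YoungDiagram) :
    Submodule (MonoidAlgebra ℂ (Equiv.Perm (Fin lam.card)))
      (MonoidAlgebra ℂ (Equiv.Perm (Fin lam.card))) :=
  Submodule.span _ {youngSymmetrizer (numbering lam)}

/-- The representation of the symmetric group on `V lam`, by left multiplication. -/
def Vrep (lam : YoungDiagram) : Representation ℂ (Equiv.Perm (Fin lam.card)) (V lam) :=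
  (Algebra.lsmul ℂ ℂ (V lam)).toMonoidHom.comp
    (MonoidAlgebra.of ℂ (Equiv.Perm (Fin lam.card)))

/-- `dim V^lam`. -/
def dimV (lam : YoungDiagram) : ℕ := Module.finrank ℂ (V lam)

/-! ### Schur polynomials -/

/-- The Schur polynomial in `N` variables: the normalised sum over the symmetric group of the
irreducible character times the power sum polynomial of the cycle type (fixed points included). -/
def schur (N : ℕ) (lam : YoungDiagram) : MvPolynomial (Fin N) ℂ :=
  MvPolynomial.C ((lam.card.factorial : ℂ)⁻¹) *
    ∑ g : Equiv.Perm (Fin lam.card),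
      MvPolynomial.C ((Vrep lam).character g) * MvPolynomial.psumPart (Fin N) ℂ g.partition

/-! ### Irreducible polynomial representations of the general linear groups -/

/-- The `d`-th tensor power of `ℂ^N`. -/
abbrev TensorPow (N d : ℕ) : Type := ⨂[ℂ] _ : Fin d, (Fin N → ℂ)

/-- The action of `S(d)` on tensors by permutation of the factors. -/
def permRep (N d : ℕ) : Representation ℂ (Equiv.Perm (Fin d)) (TensorPow N d) where
  toFun g := (PiTensorProduct.reindex ℂ (fun _ => Fin N → ℂ) g).toLinearMap
  map_one' := by
    ext x
    simp
    rfl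
  map_mul' g h := by
    ext x
    simp
    rfl

/-- The diagonal action of `GL_N(ℂ)` on tensors. -/
def glRep (N d : ℕ) : Representation ℂ (Matrix.GeneralLinearGroup (Fin N) ℂ) (TensorPow N d) where
  toFun g := PiTensorProduct.map fun _ => Matrix.toLin' (g : Matrix (Fin N) (Fin N) ℂ)
  map_one' := by
    ext x
    simp
  map_mul' g h := by
    ext x
    simp

theorem glRep_comm (N d : ℕ) (g : Matrix.GeneralLinearGroup (Fin N) ℂ)
    (c : MonoidAlgebra ℂ (Equiv.Perm (Fin d))) :
    glRep N d g ∘ₗ (permRep N d).asAlgebraHom c = (permRep N d).asAlgebraHom c ∘ₗ glRep N d g := by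
  induction c using MonoidAlgebra.induction_on with
  | of h =>
    ext x
    simp [glRep, permRep, PiTensorProduct.reindex_tprod]
  | add a b ha hb => rw [map_add, LinearMap.comp_add, LinearMap.add_comp, ha, hb]
  | smul r a ha => rw [map_smul, LinearMap.comp_smul, LinearMap.smul_comp, ha]

/-- The polynomial representation `W^lam` of `GL_N(ℂ)`: the image of the Young symmetrizer acting on
tensors. It is irreducible when `lam` has at most `N` rows, and zero otherwise. -/
def W (N : ℕ) (lam : YoungDiagram) : Subrepresentation (glRep N lam.card) where
  toSubmodule :=
    LinearMap.range ((permRep N lam.card).asAlgebraHom (youngSymmetrizer (numbering lam)))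
  apply_mem_toSubmodule g v := by
    rintro ⟨w, rfl⟩
    exact ⟨glRep N lam.card g w, (LinearMap.congr_fun (glRep_comm N lam.card g _) w).symm⟩

/-- `dim W^lam`. -/
def dimW (N : ℕ) (lam : YoungDiagram) : ℕ := Module.finrank ℂ (W N lam).toSubmodule

/-! ### The unitary group and its Haar measure -/

/-- `U(N)`. -/
abbrev U (N : ℕ) : Type := Matrix.unitaryGroup (Fin N) ℂ

instance instMeasurableSpaceU (N : ℕ) : MeasurableSpace (U N) := borel _

instance instBorelSpaceU (N : ℕ) : BorelSpace (U N) := ⟨rfl⟩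

instance instCompactSpaceU (N : ℕ) : CompactSpace (U N) := by
  refine isCompact_iff_compactSpace.1 ?_
  have hc : IsCompact (Set.univ.pi fun _ : Fin N => Set.univ.pi fun _ : Fin N =>
      Metric.closedBall (0 : ℂ) 1) :=
    isCompact_univ_pi fun _ => isCompact_univ_pi fun _ => isCompact_closedBall _ _
  refine hc.of_isClosed_subset (isClosed_unitary (R := Matrix (Fin N) (Fin N) ℂ)) ?_
  intro M hM
  simp only [Set.mem_pi, Set.mem_univ, forall_true_left, mem_closedBall_zero_iff]
  exact fun i j => entry_norm_bound_of_unitary hM i j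

/-- Haar measure on `U(N)` of total mass one. -/
def haarU (N : ℕ) : MeasureTheory.Measure (U N) := MeasureTheory.Measure.haarMeasure ⊤

/-! ### The two integrals and the terms of their expansions -/

/-- The HCIZ integral. -/
def hciz (N : ℕ) (z : ℂ) (A B : Matrix (Fin N) (Fin N) ℂ) : ℂ :=
  ∫ u : U N, Complex.exp (z * N *
    (A * (u : Matrix (Fin N) (Fin N) ℂ) * B * ((u⁻¹ : U N) : Matrix (Fin N) (Fin N) ℂ)).trace)
      ∂(haarU N)

/-- The BGW integral. -/
def bgw (N : ℕ) (z : ℂ) (A B : Matrix (Fin N) (Fin N) ℂ) : ℂ :=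
  ∫ u : U N, Complex.exp (z * N *
    (A * (u : Matrix (Fin N) (Fin N) ℂ) + B * ((u⁻¹ : U N) : Matrix (Fin N) (Fin N) ℂ)).trace)
      ∂(haarU N)

/-- `a_1, …, a_N` are the eigenvalues of `A`, with algebraic multiplicity. -/
def AreEigenvalues {N : ℕ} (A : Matrix (Fin N) (Fin N) ℂ) (a : Fin N → ℂ) : Prop :=
  A.charpoly.roots = Finset.univ.val.map a

/-- The contribution of a single Young diagram to the HCIZ expansion, at the point `(z, a, b)`. -/
def hcizDiagramTerm (N : ℕ) (lam : YoungDiagram) (p : ℂ × (Fin N → ℂ) × (Fin N → ℂ)) : ℂ :=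
  p.1 ^ lam.card / (lam.card.factorial : ℂ) * (N : ℂ) ^ lam.card *
    (MvPolynomial.eval p.2.1 (schur N lam) * MvPolynomial.eval p.2.2 (schur N lam) *
      ((dimV lam : ℂ) / (dimW N lam : ℂ)))

/-- The degree `d` term of the HCIZ expansion, at the point `(z, a, b)`. -/
def hcizTerm (N d : ℕ) (p : ℂ × (Fin N → ℂ) × (Fin N → ℂ)) : ℂ :=
  p.1 ^ d / (d.factorial : ℂ) * (N : ℂ) ^ d *
    ∑ lam ∈ diagrams N d,
      MvPolynomial.eval p.2.1 (schur N lam) * MvPolynomial.eval p.2.2 (schur N lam) *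
        ((dimV lam : ℂ) / (dimW N lam : ℂ))

/-- The contribution of a single Young diagram to the BGW expansion, at the point `(z, c)`. -/
def bgwDiagramTerm (N : ℕ) (lam : YoungDiagram) (p : ℂ × (Fin N → ℂ)) : ℂ :=
  p.1 ^ (2 * lam.card) / ((lam.card.factorial : ℂ) * (lam.card.factorial : ℂ)) *
    (N : ℂ) ^ (2 * lam.card) *
    (MvPolynomial.eval p.2 (schur N lam) * ((dimV lam : ℂ) ^ 2 / (dimW N lam : ℂ)))

/-- The degree `2d` term of the BGW expansion, at the point `(z, c)`. -/
def bgwTerm (N d : ℕ) (p : ℂ × (Fin N → ℂ)) : ℂ :=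
  p.1 ^ (2 * d) / ((d.factorial : ℂ) * (d.factorial : ℂ)) * (N : ℂ) ^ (2 * d) *
    ∑ lam ∈ diagrams N d,
      MvPolynomial.eval p.2 (schur N lam) * ((dimV lam : ℂ) ^ 2 / (dimW N lam : ℂ))

/-- The series of functions `1 + f 1 + f 2 + ⋯` converges absolutely at every point, and its
partial sums converge uniformly on compact sets. -/
def SeriesConverges {X : Type*} [TopologicalSpace X] (f : ℕ → X → ℂ) : Prop :=
  (∀ p, Summable fun d => ‖f (d + 1) p‖) ∧
    ∀ K : Set X, IsCompact K →
      TendstoUniformlyOn (fun n p => 1 + ∑ d ∈ Finset.range n, f (d + 1) p)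
        (fun p => 1 + ∑' d, f (d + 1) p) Filter.atTop K

end CharExp

end

noncomputable section

namespace CharExp

/-! ### Dominance and numberings without coincidences -/

/-! Expanding the exponentials under the integral (dominated convergence on a compact group) reduces
both formulas to moments: of Tr(AUBU⁻¹)^d for the first, and of Tr(AU)^p Tr(BU⁻¹)^q for the second.
The latter vanish for p ≠ q by invariance under scalar unitaries. The remaining moments are computed
on the d-th tensor power of ℂ^N from `avg M`, the Haar average of the conjugates of M by U^{⊗d}.

Invariance makes `avg M` commute with every U^{⊗d}. By Schur–Weyl duality
(`exists_rho_eq_of_commute_unitary`) it is therefore ρ(x) for some x in the group algebra of S(d).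
Averaging does not change traces against permutations, so with P(M) = ∑ tr(M g⁻¹) g one has P(M) = x
P(1). On tensors P(1) is inverted by an explicit central element `wein`, whence `avg M` = ρ(P(M)
`wein`) (`avg_eq`). Substituting the spectral decompositions of P(B^{⊗d}) and `wein` gives the sums
over λ.

Those decompositions come from Young symmetrizers. Different shapes are orthogonal, and a
symmetrizer c satisfies c x c ∈ ℂc; both rest on the dominance order. Thus c is κ times an
idempotent with κ = d!/dim V^λ, and averaging over conjugates gives orthogonal central idempotents.
There are at least as many shapes as cycle types, so these idempotents form a basis of the centre
and add up to 1 (`exists_eq_sum_cent`, `sum_cent`). The trace of the primitive idempotent times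
B^{⊗d} is the Schur polynomial at the eigenvalues (`trace_rho_idem_mul_kron`), because the trace of
a permutation times B^{⊗d} is a product of power sums.

For convergence, the trace of the resolution of the identity is ∑ dim V^λ dim W^λ = N^d. It bounds
both dim V^λ and the number of contributing shapes by N^d, so every numerator grows at most
exponentially in d and 1/d! wins. -/

/-- The number of cells in the first `k` rows. -/
def firstRows (lam : YoungDiagram) (k : ℕ) : ℕ := (lam.cells.filter fun c => c.1 < k).card

theorem card_filter_row_lt_col_eq (lam : YoungDiagram) (k j : ℕ) :
    (lam.cells.filter fun c => c.1 < k ∧ c.2 = j).card = min k (lam.colLen j) := by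
  have : (lam.cells.filter fun c => c.1 < k ∧ c.2 = j) =
      (Finset.range (min k (lam.colLen j))).image fun i => (i, j) := by
    ext ⟨i, j'⟩
    simp only [Finset.mem_filter, YoungDiagram.mem_cells, Finset.mem_image, Finset.mem_range,
      lt_min_iff, Prod.mk.injEq]
    constructor
    · rintro ⟨h, hk, rfl⟩
      exact ⟨i, ⟨hk, YoungDiagram.mem_iff_lt_colLen.1 h⟩, rfl, rfl⟩
    · rintro ⟨i, ⟨hk, h⟩, rfl, rfl⟩
      exact ⟨YoungDiagram.mem_iff_lt_colLen.2 h, hk, rfl⟩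
  rw [this, Finset.card_image_of_injective _ (fun a b h => by simpa using h), Finset.card_range]

/-- Counting by columns gives a form that `firstRows_le` can compare term by term. -/
theorem firstRows_eq_sum (lam : YoungDiagram) (k : ℕ) :
    firstRows lam k = ∑ j ∈ Finset.range (lam.rowLen 0), min k (lam.colLen j) := by
  rw [firstRows, Finset.card_eq_sum_card_fiberwise (f := Prod.snd)
    (t := Finset.range (lam.rowLen 0))]
  · refine Finset.sum_congr rfl fun j _ => ?_
    rw [← card_filter_row_lt_col_eq, Finset.filter_filter]
  · rintro ⟨i, j⟩ h
    simp only [Finset.coe_filter, YoungDiagram.mem_cells, Set.mem_ofPred_eq] at h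
    simp only [Finset.coe_range, Set.mem_Iio]
    exact (YoungDiagram.mem_iff_lt_rowLen.1 h.1).trans_le (lam.rowLen_anti 0 i (Nat.zero_le _))

/-- Consecutive differences recover the row lengths. This is the antisymmetry of the dominance
order. -/
theorem eq_of_firstRows_eq {lam mu : YoungDiagram} (h : ∀ k, firstRows lam k = firstRows mu k) :
    lam = mu := by
  have key : ∀ (nu : YoungDiagram) k, firstRows nu (k + 1) = firstRows nu k + nu.rowLen k := by
    intro nu k
    rw [YoungDiagram.rowLen_eq_card, firstRows, firstRows, ← Finset.card_union_of_disjoint]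
    · congr 1
      ext c
      simp only [Finset.mem_filter, YoungDiagram.mem_cells, Finset.mem_union,
        YoungDiagram.mem_row_iff, Order.lt_add_one_iff, le_iff_lt_or_eq]
      tauto
    · rw [Finset.disjoint_left]
      intro c h1 h2
      simp only [Finset.mem_filter, YoungDiagram.mem_row_iff] at h1 h2
      omega
  have hr : ∀ k, lam.rowLen k = mu.rowLen k := fun k => by
    have h1 := key lam k
    have h2 := key mu k
    have h3 := h k
    have h4 := h (k + 1)
    omega
  ext ⟨i, j⟩
  simp only [YoungDiagram.mem_cells, YoungDiagram.mem_iff_lt_rowLen, hr]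

section Coincidence

variable {d : ℕ} {lam mu : YoungDiagram}

/-- The row of the entry `e` in the numbering `t`. -/
def rowOf (t : lam.cells ≃ Fin d) (e : Fin d) : ℕ := (t.symm e).1.1

/-- The column of the entry `e` in the numbering `t`. -/
def colOf (t : lam.cells ≃ Fin d) (e : Fin d) : ℕ := (t.symm e).1.2

theorem eq_of_rowOf_colOf (t : lam.cells ≃ Fin d) {e e' : Fin d} (hr : rowOf t e = rowOf t e')
    (hc : colOf t e = colOf t e') : e = e' :=
  t.symm.injective (Subtype.ext (Prod.ext hr hc))

theorem card_rowOf_lt (t : lam.cells ≃ Fin d) (k : ℕ) :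
    (Finset.univ.filter fun e => rowOf t e < k).card = firstRows lam k := by
  rw [firstRows]
  refine Finset.card_bij (fun e _ => (t.symm e).1) ?_ ?_ ?_
  · intro e he
    simpa [rowOf, (YoungDiagram.mem_cells)] using
      And.intro (t.symm e).2 (Finset.mem_filter.1 he).2
  · intro a _ b _ h
    exact t.symm.injective (Subtype.ext h)
  · intro c hc
    rw [Finset.mem_filter] at hc
    exact ⟨t ⟨c, hc.1⟩,
      Finset.mem_filter.2 ⟨Finset.mem_univ _, by simpa [rowOf] using hc.2⟩, by simp⟩

/-- Entries in one column of `s` occupy different rows of `t`, so at most `k` of them lie in the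
first `k` rows; the column length is the other bound. -/
theorem card_rowOf_lt_colOf_eq_le (t : lam.cells ≃ Fin d) (s : mu.cells ≃ Fin d)
    (hinj : ∀ e e', rowOf t e = rowOf t e' → colOf s e = colOf s e' → e = e') (k j : ℕ) :
    (Finset.univ.filter fun e => rowOf t e < k ∧ colOf s e = j).card ≤ min k (mu.colLen j) := by
  refine le_min ?_ ?_
  · rw [← Finset.card_range k]
    refine Finset.card_le_card_of_injOn (rowOf t) ?_ ?_
    · intro e he
      simpa using (Finset.mem_filter.1 he).2.1
    · intro e he e' he' h
      have h1 := (Finset.mem_filter.1 he).2.2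
      have h2 := (Finset.mem_filter.1 he').2.2
      exact hinj e e' h (h1.trans h2.symm)
  · rw [YoungDiagram.colLen_eq_card]
    refine Finset.card_le_card_of_injOn (fun e => (s.symm e).1) ?_ ?_
    · intro e he
      have h1 := (Finset.mem_filter.1 he).2.2
      exact YoungDiagram.mem_col_iff.2 ⟨(s.symm e).2, h1⟩
    · intro e _ e' _ h
      exact s.symm.injective (Subtype.ext h)

theorem sum_card_rowOf_lt_colOf_eq (t : lam.cells ≃ Fin d) (s : mu.cells ≃ Fin d) (k : ℕ) :
    ∑ j ∈ Finset.range (mu.rowLen 0),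
      (Finset.univ.filter fun e => rowOf t e < k ∧ colOf s e = j).card = firstRows lam k := by
  rw [← card_rowOf_lt t, Finset.card_eq_sum_card_fiberwise (f := colOf s)
    (t := Finset.range (mu.rowLen 0))]
  · exact Finset.sum_congr rfl fun j _ => by rw [Finset.filter_filter]
  · intro e _
    simp only [Finset.coe_range, Set.mem_Iio]
    have h : ((s.symm e).1.1, (s.symm e).1.2) ∈ mu := (s.symm e).2
    exact (YoungDiagram.mem_iff_lt_rowLen.1 h).trans_le (mu.rowLen_anti 0 _ (Nat.zero_le _))

/-- If no two entries share a row of `t` and a column of `s`, then the shape of `s` dominates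
the shape of `t`. -/
theorem firstRows_le (t : lam.cells ≃ Fin d) (s : mu.cells ≃ Fin d)
    (hinj : ∀ e e', rowOf t e = rowOf t e' → colOf s e = colOf s e' → e = e') (k : ℕ) :
    firstRows lam k ≤ firstRows mu k := by
  rw [← sum_card_rowOf_lt_colOf_eq t s, firstRows_eq_sum mu]
  exact Finset.sum_le_sum fun j _ => card_rowOf_lt_colOf_eq_le t s hinj k j

/-- For equal shapes the inequalities of `card_rowOf_lt_colOf_eq_le` have equal sums, so each is an
equality. The entry `e` makes the count grow from `k = rowOf t e` to `k + 1`, so the minimum grows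
too, which places row `k` inside the column. -/
theorem rowOf_colOf_mem (t s : lam.cells ≃ Fin d)
    (hinj : ∀ e e', rowOf t e = rowOf t e' → colOf s e = colOf s e' → e = e') (e : Fin d) :
    (rowOf t e, colOf s e) ∈ lam := by
  have hj : colOf s e < lam.rowLen 0 := by
    have h : ((s.symm e).1.1, (s.symm e).1.2) ∈ lam := (s.symm e).2
    exact (YoungDiagram.mem_iff_lt_rowLen.1 h).trans_le (lam.rowLen_anti 0 _ (Nat.zero_le _))
  have key : ∀ k, (Finset.univ.filter fun e' => rowOf t e' < k ∧ colOf s e' = colOf s e).card =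
      min k (lam.colLen (colOf s e)) := by
    intro k
    refine (Finset.sum_eq_sum_iff_of_le
      (fun j _ => card_rowOf_lt_colOf_eq_le t s hinj k j)).1 ?_ _ (Finset.mem_range.2 hj)
    rw [sum_card_rowOf_lt_colOf_eq t s, firstRows_eq_sum]
  by_contra hmem
  rw [YoungDiagram.mem_iff_lt_colLen, not_lt] at hmem
  have h1 := key (rowOf t e)
  have h2 := key (rowOf t e + 1)
  have hlt : (Finset.univ.filter fun e' => rowOf t e' < rowOf t e ∧ colOf s e' = colOf s e).card <
      (Finset.univ.filter fun e' => rowOf t e' < rowOf t e + 1 ∧ colOf s e' = colOf s e).card := by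
    refine Finset.card_lt_card ⟨?_, ?_⟩
    · intro x hx
      simp only [Finset.mem_filter, Finset.mem_univ, true_and] at hx ⊢
      exact ⟨by omega, hx.2⟩
    · intro h
      have := h (Finset.mem_filter.2 ⟨Finset.mem_univ e, Nat.lt_succ_self _, rfl⟩)
      simp at this
  omega

theorem mem_rowPerms {t : lam.cells ≃ Fin d} {g : Equiv.Perm (Fin d)} :
    g ∈ rowPerms t ↔ ∀ e, rowOf t (g e) = rowOf t e := by
  simp [rowPerms, rowOf]

theorem mem_colPerms {t : lam.cells ≃ Fin d} {g : Equiv.Perm (Fin d)} :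
    g ∈ colPerms t ↔ ∀ e, colOf t (g e) = colOf t e := by
  simp [colPerms, colOf]

/-- If no two entries share a row of `t` and a column of `g • t`, then `g` is the product of a
row permutation and a column permutation. -/
theorem exists_row_mul_col (t : lam.cells ≃ Fin d) (g : Equiv.Perm (Fin d))
    (hinj : ∀ e e', rowOf t e = rowOf t e' → colOf (t.trans g) e = colOf (t.trans g) e' → e = e') :
    ∃ p ∈ rowPerms t, ∃ q ∈ colPerms t, g = p * q := by
  -- The inverse `u` of `v` is a numbering with the rows of `t` and the columns of `g • t`. The
  -- permutation from `t` to `u` preserves rows, and what remains of `g` preserves columns.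
  let v : Fin d → lam.cells := fun e => ⟨(rowOf t e, colOf (t.trans g) e),
    rowOf_colOf_mem t (t.trans g) hinj e⟩
  have hv : Function.Bijective v := by
    rw [Fintype.bijective_iff_injective_and_card]
    refine ⟨fun e e' h => ?_, (Fintype.card_congr t).symm⟩
    have h' := congrArg Subtype.val h
    exact hinj e e' (Prod.ext_iff.1 h').1 (Prod.ext_iff.1 h').2
  let u : lam.cells ≃ Fin d := (Equiv.ofBijective v hv).symm
  have hrow : ∀ c, rowOf t (u c) = c.1.1 := fun c => by
    have h : v (u c) = c := (Equiv.ofBijective v hv).apply_symm_apply c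
    exact congrArg (fun c => c.1.1) h
  have hcol : ∀ c, colOf (t.trans g) (u c) = c.1.2 := fun c => by
    have h : v (u c) = c := (Equiv.ofBijective v hv).apply_symm_apply c
    exact congrArg (fun c => c.1.2) h
  have hcol' : ∀ x, colOf t (g⁻¹ x) = colOf (t.trans g) x := fun x => rfl
  let p : Equiv.Perm (Fin d) := t.symm.trans u
  have hp : p ∈ rowPerms t := mem_rowPerms.2 fun e => by
    simp only [p, Equiv.trans_apply, hrow]; rfl
  refine ⟨p, hp, p⁻¹ * g, ?_, by group⟩
  have hq : g⁻¹ * p ∈ colPerms t := mem_colPerms.2 fun e => by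
    rw [Equiv.Perm.mul_apply, hcol']
    simp only [p, Equiv.trans_apply, hcol]; rfl
  rw [mem_colPerms] at hq ⊢
  intro e
  have := hq ((p⁻¹ * g) e)
  rw [← this]
  simp

end Coincidence

/-! ### Row and column sums in the group algebra -/

section Symmetrizer

variable {d : ℕ} {lam mu : YoungDiagram}

/-- The group algebra of the symmetric group. -/
abbrev GA (d : ℕ) : Type := MonoidAlgebra ℂ (Equiv.Perm (Fin d))

/-- The sum of the row permutations. -/
def rowSum (t : lam.cells ≃ Fin d) : GA d := ∑ g ∈ rowPerms t, MonoidAlgebra.single g 1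

/-- The signed sum of the column permutations. -/
def colSum (t : lam.cells ≃ Fin d) : GA d :=
  ∑ g ∈ colPerms t, MonoidAlgebra.single g ((Equiv.Perm.sign g : ℤ) : ℂ)

theorem youngSymmetrizer_eq (t : lam.cells ≃ Fin d) :
    youngSymmetrizer t = rowSum t * colSum t := rfl

theorem eq_zero_of_eq_neg {x : GA d} (h : x = -x) : x = 0 := by
  have h2 : (2 : ℂ) • x = 0 := by
    rw [two_smul]
    nth_rewrite 1 [h]
    exact neg_add_cancel x
  have h3 := congrArg ((2 : ℂ)⁻¹ • ·) h2
  simpa using h3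

theorem mul_mem_rowPerms {t : lam.cells ≃ Fin d} {g h : Equiv.Perm (Fin d)}
    (hg : g ∈ rowPerms t) (hh : h ∈ rowPerms t) : g * h ∈ rowPerms t := by
  rw [mem_rowPerms] at *
  intro e
  rw [Equiv.Perm.mul_apply, hg, hh]

theorem inv_mem_rowPerms {t : lam.cells ≃ Fin d} {g : Equiv.Perm (Fin d)}
    (hg : g ∈ rowPerms t) : g⁻¹ ∈ rowPerms t := by
  rw [mem_rowPerms] at *
  intro e
  rw [← hg]
  simp

theorem mul_mem_colPerms {t : lam.cells ≃ Fin d} {g h : Equiv.Perm (Fin d)}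
    (hg : g ∈ colPerms t) (hh : h ∈ colPerms t) : g * h ∈ colPerms t := by
  rw [mem_colPerms] at *
  intro e
  rw [Equiv.Perm.mul_apply, hg, hh]

theorem inv_mem_colPerms {t : lam.cells ≃ Fin d} {g : Equiv.Perm (Fin d)}
    (hg : g ∈ colPerms t) : g⁻¹ ∈ colPerms t := by
  rw [mem_colPerms] at *
  intro e
  rw [← hg]
  simp

theorem single_mul_rowSum {t : lam.cells ≃ Fin d} {p : Equiv.Perm (Fin d)}
    (hp : p ∈ rowPerms t) : (MonoidAlgebra.single p 1 : GA d) * rowSum t = rowSum t := by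
  rw [rowSum, Finset.mul_sum]
  refine Finset.sum_bij' (fun g _ => p * g) (fun g _ => p⁻¹ * g)
    (fun g hg => mul_mem_rowPerms hp hg) (fun g hg => mul_mem_rowPerms (inv_mem_rowPerms hp) hg)
    ?_ ?_ ?_ <;> simp [MonoidAlgebra.single_mul_single]

theorem rowSum_mul_single {t : lam.cells ≃ Fin d} {p : Equiv.Perm (Fin d)}
    (hp : p ∈ rowPerms t) : rowSum t * (MonoidAlgebra.single p 1 : GA d) = rowSum t := by
  rw [rowSum, Finset.sum_mul]
  refine Finset.sum_bij' (fun g _ => g * p) (fun g _ => g * p⁻¹)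
    (fun g hg => mul_mem_rowPerms hg hp) (fun g hg => mul_mem_rowPerms hg (inv_mem_rowPerms hp))
    ?_ ?_ ?_ <;> simp [MonoidAlgebra.single_mul_single]

theorem sign_cast_mul_self (q : Equiv.Perm (Fin d)) :
    ((Equiv.Perm.sign q : ℤ) : ℂ) * ((Equiv.Perm.sign q : ℤ) : ℂ) = 1 := by
  rcases Int.units_eq_one_or (Equiv.Perm.sign q) with h | h <;> simp [h]

theorem single_mul_colSum {t : lam.cells ≃ Fin d} {q : Equiv.Perm (Fin d)}
    (hq : q ∈ colPerms t) : (MonoidAlgebra.single q 1 : GA d) * colSum t =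
      ((Equiv.Perm.sign q : ℤ) : ℂ) • colSum t := by
  rw [colSum, Finset.mul_sum, Finset.smul_sum]
  refine Finset.sum_bij' (fun g _ => q * g) (fun g _ => q⁻¹ * g)
    (fun g hg => mul_mem_colPerms hq hg) (fun g hg => mul_mem_colPerms (inv_mem_colPerms hq) hg)
    ?_ ?_ ?_
  · simp
  · simp
  · intro g _
    simp [MonoidAlgebra.single_mul_single, ← mul_assoc, sign_cast_mul_self]

theorem colSum_mul_single {t : lam.cells ≃ Fin d} {q : Equiv.Perm (Fin d)}
    (hq : q ∈ colPerms t) : colSum t * (MonoidAlgebra.single q 1 : GA d) =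
      ((Equiv.Perm.sign q : ℤ) : ℂ) • colSum t := by
  rw [colSum, Finset.sum_mul, Finset.smul_sum]
  refine Finset.sum_bij' (fun g _ => g * q) (fun g _ => g * q⁻¹)
    (fun g hg => mul_mem_colPerms hg hq) (fun g hg => mul_mem_colPerms hg (inv_mem_colPerms hq))
    ?_ ?_ ?_
  · simp
  · simp
  · intro g _
    rw [MonoidAlgebra.single_mul_single, MonoidAlgebra.smul_single, Equiv.Perm.sign_mul,
      mul_comm (Equiv.Perm.sign g)]
    simp [← mul_assoc, sign_cast_mul_self]

theorem swap_mem_rowPerms {t : lam.cells ≃ Fin d} {e e' : Fin d} (h : rowOf t e = rowOf t e') :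
    Equiv.swap e e' ∈ rowPerms t := by
  rw [mem_rowPerms]
  intro x
  rw [Equiv.swap_apply_def]
  split_ifs with h1 h2 <;> simp_all

theorem swap_mem_colPerms {t : lam.cells ≃ Fin d} {e e' : Fin d} (h : colOf t e = colOf t e') :
    Equiv.swap e e' ∈ colPerms t := by
  rw [mem_colPerms]
  intro x
  rw [Equiv.swap_apply_def]
  split_ifs with h1 h2 <;> simp_all

theorem single_conj_swap (g : Equiv.Perm (Fin d)) (e e' : Fin d) :
    (MonoidAlgebra.single (Equiv.swap e e') 1 : GA d) * MonoidAlgebra.single g 1 =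
      MonoidAlgebra.single g 1 * MonoidAlgebra.single (Equiv.swap (g⁻¹ e) (g⁻¹ e')) 1 := by
  rw [MonoidAlgebra.single_mul_single, MonoidAlgebra.single_mul_single]
  congr 1
  have := Equiv.mul_swap_eq_swap_mul g (g⁻¹ e) (g⁻¹ e')
  simpa using this.symm

/-- The transposition of `e` and `e'` is absorbed by the row sum; moved past `g` it becomes a column
transposition of `s` and produces the sign -1. -/
theorem rowSum_mul_single_mul_colSum (t : lam.cells ≃ Fin d) (s : mu.cells ≃ Fin d)
    (g : Equiv.Perm (Fin d)) {e e' : Fin d} (hne : e ≠ e') (hr : rowOf t e = rowOf t e')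
    (hc : colOf (s.trans g) e = colOf (s.trans g) e') :
    rowSum t * MonoidAlgebra.single g 1 * colSum s = 0 := by
  have hs : Equiv.swap (g⁻¹ e) (g⁻¹ e') ∈ colPerms s := swap_mem_colPerms hc
  have h1 : rowSum t * MonoidAlgebra.single g 1 * colSum s =
      -(rowSum t * MonoidAlgebra.single g 1 * colSum s) := by
    conv_lhs => rw [← rowSum_mul_single (swap_mem_rowPerms hr), mul_assoc (rowSum t),
      single_conj_swap, mul_assoc, mul_assoc, single_mul_colSum hs,
      Equiv.Perm.sign_swap (g⁻¹.injective.ne hne)]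
    simp [mul_assoc]
  exact eq_zero_of_eq_neg h1

theorem colSum_mul_single_mul_rowSum (t : lam.cells ≃ Fin d) (s : mu.cells ≃ Fin d)
    (g : Equiv.Perm (Fin d)) {e e' : Fin d} (hne : e ≠ e') (hc : colOf t e = colOf t e')
    (hr : rowOf (s.trans g) e = rowOf (s.trans g) e') :
    colSum t * MonoidAlgebra.single g 1 * rowSum s = 0 := by
  have hs : Equiv.swap (g⁻¹ e) (g⁻¹ e') ∈ rowPerms s := swap_mem_rowPerms hr
  have h1 : colSum t * MonoidAlgebra.single g 1 * rowSum s =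
      -(colSum t * MonoidAlgebra.single g 1 * rowSum s) := by
    have h2 := congrArg (· * (MonoidAlgebra.single g 1 * rowSum s))
      (colSum_mul_single (swap_mem_colPerms hc))
    simp only [Equiv.Perm.sign_swap hne] at h2
    rw [mul_assoc, ← mul_assoc (MonoidAlgebra.single (Equiv.swap e e') 1), single_conj_swap,
      mul_assoc (MonoidAlgebra.single g 1), single_mul_rowSum hs] at h2
    simpa [mul_assoc] using h2
  exact eq_zero_of_eq_neg h1

theorem mul_mul_eq_zero_of_single {x z : GA d}
    (h : ∀ g, x * MonoidAlgebra.single g 1 * z = 0) (y : GA d) : x * y * z = 0 := by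
  induction y using MonoidAlgebra.induction_on with
  | of g => exact h g
  | add a b ha hb => rw [mul_add, add_mul, ha, hb, add_zero]
  | smul r a ha => rw [mul_smul_comm, smul_mul_assoc, ha, smul_zero]

/-- Young symmetrizers of different shapes are orthogonal. -/
theorem youngSymmetrizer_mul_mul_eq_zero (t : lam.cells ≃ Fin d) (s : mu.cells ≃ Fin d)
    (hne : lam ≠ mu) (x : GA d) : youngSymmetrizer t * x * youngSymmetrizer s = 0 := by
  rw [youngSymmetrizer_eq, youngSymmetrizer_eq]
  -- The product contains both a row-column factor and a column-row factor. A nonzero instance of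
  -- the first gives dominance one way, a nonzero instance of the second the other way, so if
  -- neither vanishes identically the shapes agree.
  by_cases h1 : ∀ g, rowSum t * MonoidAlgebra.single g 1 * colSum s = 0
  · have := mul_mul_eq_zero_of_single h1 (colSum t * x * rowSum s)
    simpa only [mul_assoc] using this
  by_cases h2 : ∀ g, colSum t * MonoidAlgebra.single g 1 * rowSum s = 0
  · have := mul_mul_eq_zero_of_single h2 x
    calc _ = rowSum t * (colSum t * x * rowSum s) * colSum s := by simp only [mul_assoc]
      _ = 0 := by rw [this]; simp
  exfalso
  push Not at h1 h2
  obtain ⟨g, hg⟩ := h1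
  obtain ⟨h, hh⟩ := h2
  refine hne (eq_of_firstRows_eq fun k => le_antisymm ?_ ?_)
  · refine firstRows_le t (s.trans g) (fun e e' hr hc => ?_) k
    by_contra hee
    exact hg (rowSum_mul_single_mul_colSum t s g hee hr hc)
  · refine firstRows_le (s.trans h) t (fun e e' hr hc => ?_) k
    by_contra hee
    exact hh (colSum_mul_single_mul_rowSum t s h hee hc hr)

/-! ### Coefficients of a Young symmetrizer and the sandwich property -/

theorem row_col_unique {t : lam.cells ≃ Fin d} {p q p' q' : Equiv.Perm (Fin d)}
    (hp : p ∈ rowPerms t) (hq : q ∈ colPerms t) (hp' : p' ∈ rowPerms t) (hq' : q' ∈ colPerms t)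
    (h : p * q = p' * q') : p = p' ∧ q = q' := by
  have h1 : p'⁻¹ * p = q' * q⁻¹ := by
    rw [inv_mul_eq_iff_eq_mul, ← mul_assoc, ← h]; group
  have hr := mem_rowPerms.1 (mul_mem_rowPerms (inv_mem_rowPerms hp') hp)
  have hc := mem_colPerms.1 (mul_mem_colPerms hq' (inv_mem_colPerms hq))
  rw [← h1] at hc
  have h2 : p'⁻¹ * p = 1 := Equiv.ext fun e => eq_of_rowOf_colOf t (hr e) (hc e)
  have h3 : p = p' := by rwa [inv_mul_eq_one, eq_comm] at h2
  refine ⟨h3, ?_⟩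
  rw [h3] at h
  exact mul_left_cancel h

theorem youngSymmetrizer_coeff (t : lam.cells ≃ Fin d) (g : Equiv.Perm (Fin d)) :
    (youngSymmetrizer t).coeff g = ∑ x ∈ (rowPerms t ×ˢ colPerms t).filter
      (fun x => x.1 * x.2 = g), ((Equiv.Perm.sign x.2 : ℤ) : ℂ) := by
  rw [youngSymmetrizer, Finset.sum_mul_sum, ← Finset.sum_product', MonoidAlgebra.coeff_sum,
    Finset.sum_filter, Finsupp.finsetSum_apply]
  refine Finset.sum_congr rfl fun x _ => ?_
  rw [MonoidAlgebra.single_mul_single, MonoidAlgebra.coeff_single, Finsupp.single_apply, one_mul]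

theorem youngSymmetrizer_coeff_one (t : lam.cells ≃ Fin d) :
    (youngSymmetrizer t).coeff 1 = 1 := by
  have h1r : (1 : Equiv.Perm (Fin d)) ∈ rowPerms t := mem_rowPerms.2 fun _ => rfl
  have h1c : (1 : Equiv.Perm (Fin d)) ∈ colPerms t := mem_colPerms.2 fun _ => rfl
  rw [youngSymmetrizer_coeff, Finset.sum_eq_single_of_mem (1, 1)]
  · simp
  · simp [h1r, h1c]
  · rintro ⟨p, q⟩ hx hne
    simp only [Finset.mem_filter, Finset.mem_product] at hx
    obtain ⟨rfl, rfl⟩ := row_col_unique hx.1.1 hx.1.2 h1r h1c (by simpa using hx.2)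
    exact (hne rfl).elim

/-- A permutation factors in at most one way as row times column, so each coefficient is 0 or a
sign. This is the source of the bound on characters. -/
theorem norm_youngSymmetrizer_coeff_le (t : lam.cells ≃ Fin d) (g : Equiv.Perm (Fin d)) :
    ‖(youngSymmetrizer t).coeff g‖ ≤ 1 := by
  rw [youngSymmetrizer_coeff]
  refine (norm_sum_le _ _).trans ?_
  have h1 : ∀ q : Equiv.Perm (Fin d), ‖((Equiv.Perm.sign q : ℤ) : ℂ)‖ = 1 := fun q => by
    rcases Int.units_eq_one_or (Equiv.Perm.sign q) with h | h <;> simp [h]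
  simp only [h1, Finset.sum_const, nsmul_eq_mul, mul_one]
  norm_cast
  rw [Finset.card_le_one]
  rintro ⟨p, q⟩ hx ⟨p', q'⟩ hx'
  simp only [Finset.mem_filter, Finset.mem_product] at hx hx'
  obtain ⟨rfl, rfl⟩ := row_col_unique hx.1.1 hx.1.2 hx'.1.1 hx'.1.2 (hx.2.trans hx'.2.symm)
  rfl

/-- For a single permutation there are two cases: it factors as row times column, and the sums
absorb the factors up to sign, or two entries share a row and a column, and the product is 0. The
scalar is read off at 1, where the symmetrizer has coefficient 1. -/
theorem rowSum_mul_mul_colSum (t : lam.cells ≃ Fin d) (x : GA d) :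
    rowSum t * x * colSum t = (rowSum t * x * colSum t).coeff 1 • youngSymmetrizer t := by
  induction x using MonoidAlgebra.induction_on with
  | of g =>
    rw [MonoidAlgebra.of_apply]
    by_cases h : ∀ e e', rowOf t e = rowOf t e' →
        colOf (t.trans g) e = colOf (t.trans g) e' → e = e'
    · obtain ⟨p, hp, q, hq, rfl⟩ := exists_row_mul_col t g h
      have h1 : rowSum t * MonoidAlgebra.single (p * q) 1 * colSum t =
          ((Equiv.Perm.sign q : ℤ) : ℂ) • youngSymmetrizer t := by
        rw [← one_mul (1 : ℂ), ← MonoidAlgebra.single_mul_single, ← mul_assoc,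
          rowSum_mul_single hp, mul_assoc, single_mul_colSum hq, mul_smul_comm,
          youngSymmetrizer_eq]
      rw [h1, MonoidAlgebra.coeff_smul_apply, youngSymmetrizer_coeff_one, smul_eq_mul, mul_one]
    · push Not at h
      obtain ⟨e, e', hr, hc, hne⟩ := h
      rw [rowSum_mul_single_mul_colSum t t g hne hr hc]
      simp
  | add a b ha hb =>
    rw [mul_add, add_mul, MonoidAlgebra.coeff_add, Finsupp.add_apply, add_smul, ← ha, ← hb]
  | smul r a ha =>
    rw [mul_smul_comm, smul_mul_assoc, MonoidAlgebra.coeff_smul_apply, smul_assoc, ← ha]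

theorem youngSymmetrizer_mul_mul (t : lam.cells ≃ Fin d) (x : GA d) :
    youngSymmetrizer t * x * youngSymmetrizer t =
      (youngSymmetrizer t * x * youngSymmetrizer t).coeff 1 • youngSymmetrizer t := by
  have := rowSum_mul_mul_colSum t (colSum t * x * rowSum t)
  simpa only [youngSymmetrizer_eq, mul_assoc] using this

end Symmetrizer

end CharExp

end

noncomputable section

namespace CharExp

/-! ### The Young symmetrizers of all shapes with `d` cells -/

/-- Young diagrams with `d` cells. -/
abbrev Shape (d : ℕ) : Type := {lam : YoungDiagram // lam.card = d}

theorem numRows_le_card (lam : YoungDiagram) : numRows lam ≤ lam.card := by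
  rw [numRows, lam.colLen_eq_card]
  exact Finset.card_le_card (Finset.filter_subset _ _)

instance (d : ℕ) : Finite (Shape d) :=
  ((finite_diagrams d d).subset fun lam (h : lam.card = d) =>
    ⟨h, h ▸ numRows_le_card lam⟩ : {lam : YoungDiagram | lam.card = d}.Finite).to_subtype

instance (d : ℕ) : Fintype (Shape d) := Fintype.ofFinite _

variable {d : ℕ}

/-- The Young symmetrizer of a shape, for the standard numbering. -/
def sym (l : Shape d) : GA d := youngSymmetrizer ((numbering l.1).trans (finCongr l.2))

theorem sym_mk (lam : YoungDiagram) :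
    sym (⟨lam, rfl⟩ : Shape lam.card) = youngSymmetrizer (numbering lam) := rfl

theorem trace_groupAlgebra (f : GA d →ₗ[ℂ] GA d) :
    LinearMap.trace ℂ (GA d) f = ∑ h, (f (MonoidAlgebra.single h 1)).coeff h := by
  rw [LinearMap.trace_eq_matrix_trace ℂ (MonoidAlgebra.basis (Equiv.Perm (Fin d)) ℂ),
    Matrix.trace]
  refine Finset.sum_congr rfl fun h _ => ?_
  rw [Matrix.diag_apply, LinearMap.toMatrix_apply]
  rfl

theorem groupAlgebra_eq_sum (x : GA d) : x = ∑ g, x.coeff g • MonoidAlgebra.single g (1 : ℂ) := by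
  refine MonoidAlgebra.coeff_injective (Finsupp.ext fun h => ?_)
  rw [MonoidAlgebra.coeff_sum, Finsupp.finsetSum_apply]
  simp [Finsupp.single_apply]

theorem coeff_mul_comm_one (x y : GA d) : (x * y).coeff 1 = (y * x).coeff 1 := by
  induction x using MonoidAlgebra.induction_on with
  | of g => simp
  | add a b ha hb => simp [add_mul, mul_add, ha, hb]
  | smul r a ha => simp [ha]

/-- The scalar `κ` with `c * c = κ • c` for the Young symmetrizer `c`. -/
def kap (l : Shape d) : ℂ := (sym l * sym l).coeff 1

theorem sym_mul_sym (l : Shape d) : sym l * sym l = kap l • sym l := by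
  have h : sym l * 1 * sym l = (sym l * 1 * sym l).coeff 1 • sym l := youngSymmetrizer_mul_mul _ 1
  rwa [mul_one] at h

theorem sym_coeff_one (l : Shape d) : (sym l).coeff 1 = 1 := youngSymmetrizer_coeff_one _

theorem trace_mulRight_sym (l : Shape d) :
    LinearMap.trace ℂ (GA d) (LinearMap.mulRight ℂ (sym l)) = d.factorial := by
  rw [trace_groupAlgebra]
  simp [sym_coeff_one, Fintype.card_perm]

/-- Otherwise right multiplication by the symmetrizer would square to zero and have trace 0, but its
trace is d! times the coefficient at 1, that is d!. -/
theorem kap_ne_zero (l : Shape d) : kap l ≠ 0 := by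
  intro h
  have hn : IsNilpotent (LinearMap.mulRight ℂ (sym l)) := by
    refine ⟨2, LinearMap.ext fun x => ?_⟩
    rw [pow_two, Module.End.mul_apply, LinearMap.mulRight_apply, LinearMap.mulRight_apply,
      mul_assoc, sym_mul_sym, h]
    simp
  have := (LinearMap.isNilpotent_trace_of_isNilpotent hn).eq_zero
  rw [trace_mulRight_sym] at this
  exact d.factorial_ne_zero (by exact_mod_cast this)

/-- The primitive idempotent proportional to the Young symmetrizer. -/
def idem (l : Shape d) : GA d := (kap l)⁻¹ • sym l

theorem idem_mul_idem (l : Shape d) : idem l * idem l = idem l := by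
  rw [idem, smul_mul_smul_comm, sym_mul_sym, smul_smul]
  congr 1
  field_simp [kap_ne_zero l]

theorem sym_eq_smul_idem (l : Shape d) : sym l = kap l • idem l := by
  rw [idem, smul_smul, mul_inv_cancel₀ (kap_ne_zero l), one_smul]

theorem idem_coeff_one (l : Shape d) : (idem l).coeff 1 = (kap l)⁻¹ := by
  simp [idem, sym_coeff_one]

/-- The factor `kap l` is there because the idempotent has coefficient `(kap l)⁻¹` at 1. -/
theorem idem_mul_mul_idem (l : Shape d) (x : GA d) :
    idem l * x * idem l = (kap l * (idem l * x * idem l).coeff 1) • idem l := by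
  have h : sym l * x * sym l = (sym l * x * sym l).coeff 1 • sym l := youngSymmetrizer_mul_mul _ x
  have hk := kap_ne_zero l
  rw [idem, smul_mul_assoc, smul_mul_assoc, mul_smul_comm, h]
  simp only [MonoidAlgebra.coeff_smul_apply, sym_coeff_one, smul_smul, smul_eq_mul]
  congr 1
  field_simp

theorem idem_mul_mul_idem_of_ne {l m : Shape d} (h : l ≠ m) (x : GA d) :
    idem l * x * idem m = 0 := by
  have : sym l * x * sym m = 0 :=
    youngSymmetrizer_mul_mul_eq_zero _ _ (fun e => h (Subtype.ext e)) x
  rw [idem, idem, smul_mul_assoc, smul_mul_assoc, mul_smul_comm, this, smul_zero, smul_zero]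

/-! ### Dimensions and characters -/

theorem mem_V_iff (lam : YoungDiagram) (x : GA lam.card) :
    x ∈ V lam ↔ x * idem (⟨lam, rfl⟩ : Shape lam.card) = x := by
  rw [V, Submodule.mem_span_singleton, ← sym_mk]
  constructor
  · rintro ⟨a, rfl⟩
    rw [smul_eq_mul, sym_eq_smul_idem, mul_smul_comm, smul_mul_assoc, mul_assoc, idem_mul_idem]
  · intro h
    refine ⟨(kap (⟨lam, rfl⟩ : Shape lam.card))⁻¹ • x, ?_⟩
    rw [smul_eq_mul, smul_mul_assoc, ← mul_smul_comm, ← idem, h]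

/-- The character of a shape, in terms of its primitive idempotent. -/
def chi (l : Shape d) (g : Equiv.Perm (Fin d)) : ℂ := ∑ h, (idem l).coeff (h⁻¹ * g⁻¹ * h)

theorem character_Vrep (lam : YoungDiagram) (g : Equiv.Perm (Fin lam.card)) :
    (Vrep lam).character g = chi (⟨lam, rfl⟩ : Shape lam.card) g := by
  set l : Shape lam.card := ⟨lam, rfl⟩
  -- The map x ↦ g x e sends the whole algebra into `V lam` and agrees with g there, so its trace on
  -- the algebra, computable in the basis of permutations, is the character.
  let f : GA lam.card →ₗ[ℂ] GA lam.card :=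
    LinearMap.mulLeft ℂ (MonoidAlgebra.single g 1) ∘ₗ LinearMap.mulRight ℂ (idem l)
  have hf : ∀ x, f x ∈ (V lam).restrictScalars ℂ := fun x => by
    rw [Submodule.restrictScalars_mem, mem_V_iff]
    simp only [f, LinearMap.comp_apply, LinearMap.mulLeft_apply, LinearMap.mulRight_apply]
    rw [mul_assoc, mul_assoc, idem_mul_idem]
  have h1 := LinearMap.trace_restrict_eq_of_forall_mem ((V lam).restrictScalars ℂ) f hf
  let r : V lam →ₗ[ℂ] V lam := by
    exact f.restrict (fun x (_ : x ∈ (V lam).restrictScalars ℂ) => hf x)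
  have h2 : Vrep lam g = r := by
    refine LinearMap.ext fun x => Subtype.ext ?_
    have hx := (mem_V_iff lam x.1).1 x.2
    change MonoidAlgebra.single g 1 * x.1 = MonoidAlgebra.single g 1 * (x.1 * idem l)
    rw [hx]
  rw [Representation.character, h2]
  refine h1.trans ?_
  rw [trace_groupAlgebra, chi]
  refine Finset.sum_congr rfl fun h _ => ?_
  simp [f, ← mul_assoc]

theorem chi_one (l : Shape d) : chi l 1 = d.factorial * (kap l)⁻¹ := by
  simp [chi, idem_coeff_one, Fintype.card_perm]

theorem dimV_eq (l : Shape d) : (dimV l.1 : ℂ) = d.factorial * (kap l)⁻¹ := by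
  obtain ⟨lam, rfl⟩ := l
  rw [← chi_one, ← character_Vrep, Representation.char_one, dimV]

/-- The character is a sum of d! coefficients, each of modulus at most 1/|κ|, and d!/κ is the
dimension; no unitary structure is needed. -/
theorem norm_chi_le (l : Shape d) (g : Equiv.Perm (Fin d)) : ‖chi l g‖ ≤ dimV l.1 := by
  have h : (dimV l.1 : ℝ) = ‖(dimV l.1 : ℂ)‖ := by simp
  rw [h, dimV_eq, norm_mul, chi]
  refine (norm_sum_le _ _).trans ?_
  have h2 : ∀ h ∈ (Finset.univ : Finset (Equiv.Perm (Fin d))),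
      ‖(idem l).coeff (h⁻¹ * g⁻¹ * h)‖ ≤ ‖(kap l)⁻¹‖ := fun h _ => by
    rw [idem, MonoidAlgebra.coeff_smul_apply, norm_smul]
    exact mul_le_of_le_one_right (norm_nonneg _) (norm_youngSymmetrizer_coeff_le _ _)
  refine (Finset.sum_le_card_nsmul _ _ _ h2).trans ?_
  simp [Fintype.card_perm]

/-! ### Central idempotents -/

/-- The class sum `∑ g, χ(g⁻¹) g`. -/
def classSum (l : Shape d) : GA d :=
  ∑ h : Equiv.Perm (Fin d), MonoidAlgebra.single h 1 * idem l * MonoidAlgebra.single h⁻¹ 1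

theorem classSum_coeff (l : Shape d) (g : Equiv.Perm (Fin d)) :
    (classSum l).coeff g = chi l g⁻¹ := by
  rw [classSum, MonoidAlgebra.coeff_sum, Finsupp.finsetSum_apply, chi]
  refine Finset.sum_congr rfl fun h _ => ?_
  simp [mul_assoc]

theorem single_mul_classSum (l : Shape d) (g : Equiv.Perm (Fin d)) :
    MonoidAlgebra.single g 1 * classSum l = classSum l * MonoidAlgebra.single g 1 := by
  rw [classSum, Finset.mul_sum, Finset.sum_mul]
  refine Fintype.sum_equiv (Equiv.mulLeft g) _ _ fun h => ?_
  rw [← mul_assoc, ← mul_assoc, MonoidAlgebra.single_mul_single, mul_assoc _ _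
    (MonoidAlgebra.single g 1), MonoidAlgebra.single_mul_single]
  simp

theorem classSum_comm (l : Shape d) (x : GA d) : x * classSum l = classSum l * x := by
  induction x using MonoidAlgebra.induction_on with
  | of g => exact single_mul_classSum l g
  | add a b ha hb => rw [add_mul, mul_add, ha, hb]
  | smul r a ha => rw [smul_mul_assoc, mul_smul_comm, ha]

/-- The sandwich property turns h e h⁻¹ e into κ e(h) h e, where e(h) is the coefficient of e at h.
Summed over h this is κ e e = κ e. -/
theorem classSum_mul_idem (l : Shape d) : classSum l * idem l = kap l • idem l := by
  have h1 : ∀ h : Equiv.Perm (Fin d),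
      MonoidAlgebra.single h 1 * idem l * MonoidAlgebra.single h⁻¹ 1 * idem l =
        kap l • ((idem l).coeff h • MonoidAlgebra.single h 1 * idem l) := fun h => by
    rw [mul_assoc, mul_assoc, ← mul_assoc (idem l), idem_mul_mul_idem, coeff_mul_comm_one,
      ← mul_assoc, idem_mul_idem]
    simp only [MonoidAlgebra.coeff_mul_single_apply, inv_inv, one_mul, mul_one, mul_smul_comm,
      smul_mul_assoc, smul_smul]
  rw [classSum, Finset.sum_mul, Finset.sum_congr rfl fun h _ => h1 h, ← Finset.smul_sum,
    ← Finset.sum_mul, ← groupAlgebra_eq_sum, idem_mul_idem]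

theorem classSum_mul_idem_of_ne {l m : Shape d} (h : l ≠ m) : classSum l * idem m = 0 := by
  rw [classSum, Finset.sum_mul]
  refine Finset.sum_eq_zero fun g _ => ?_
  rw [mul_assoc, mul_assoc, ← mul_assoc (idem l), idem_mul_mul_idem_of_ne h, mul_zero]

/-- A central factor passes inside the conjugation, so products of central idempotents reduce to
products with a primitive one. -/
theorem mul_classSum (x : GA d) (hx : ∀ y, y * x = x * y) (m : Shape d) :
    x * classSum m = ∑ h : Equiv.Perm (Fin d),
      MonoidAlgebra.single h 1 * (x * idem m) * MonoidAlgebra.single h⁻¹ 1 := by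
  rw [classSum, Finset.mul_sum]
  refine Finset.sum_congr rfl fun h _ => ?_
  simp only [← mul_assoc]
  rw [hx]

/-- The central idempotent of a shape. -/
def cent (l : Shape d) : GA d := (kap l)⁻¹ • classSum l

theorem cent_comm (l : Shape d) (x : GA d) : x * cent l = cent l * x := by
  rw [cent, mul_smul_comm, smul_mul_assoc, classSum_comm]

theorem cent_mul_idem (l : Shape d) : cent l * idem l = idem l := by
  rw [cent, smul_mul_assoc, classSum_mul_idem, smul_smul, inv_mul_cancel₀ (kap_ne_zero l),
    one_smul]

theorem cent_mul_self (l : Shape d) : cent l * cent l = cent l := by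
  have h : cent l * classSum l = classSum l := by
    rw [mul_classSum _ (cent_comm l), cent_mul_idem, classSum]
  calc cent l * cent l = (kap l)⁻¹ • (cent l * classSum l) := by rw [← mul_smul_comm, ← cent]
    _ = cent l := by rw [h, ← cent]

theorem cent_mul_of_ne {l m : Shape d} (h : l ≠ m) : cent l * cent m = 0 := by
  rw [cent, cent, mul_smul_comm, smul_mul_assoc, mul_classSum _ (classSum_comm l),
    classSum_mul_idem_of_ne h]
  simp

theorem cent_ne_zero (l : Shape d) : cent l ≠ 0 := by
  intro h
  have h1 := cent_mul_idem l
  rw [h, zero_mul] at h1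
  have h2 := idem_coeff_one l
  rw [← h1] at h2
  exact inv_ne_zero (kap_ne_zero l) h2.symm

theorem sum_smul_cent_mul_cent (a : Shape d → ℂ) (m : Shape d) :
    (∑ l, a l • cent l) * cent m = a m • cent m := by
  rw [Finset.sum_mul, Finset.sum_eq_single m]
  · rw [smul_mul_assoc, cent_mul_self]
  · intro l _ h
    rw [smul_mul_assoc, cent_mul_of_ne h, smul_zero]
  · simp

theorem linearIndependent_cent : LinearIndependent ℂ (cent : Shape d → GA d) := by
  rw [Fintype.linearIndependent_iff]
  intro a ha m
  have h := sum_smul_cent_mul_cent a m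
  rw [ha, zero_mul] at h
  exact (smul_eq_zero.1 h.symm).resolve_right (cent_ne_zero m)

/-! ### Dimension of the centre and resolution of the identity -/

/-- The centre of the group algebra. -/
def center (d : ℕ) : Submodule ℂ (GA d) where
  carrier := {x | ∀ y, y * x = x * y}
  add_mem' ha hb y := by rw [mul_add, add_mul, ha y, hb y]
  zero_mem' y := by simp
  smul_mem' r x hx y := by rw [mul_smul_comm, smul_mul_assoc, hx y]

theorem coeff_eq_of_isConj {x : GA d} (hx : x ∈ center d) {g h : Equiv.Perm (Fin d)}
    (hgh : IsConj g h) : x.coeff g = x.coeff h := by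
  obtain ⟨c, rfl⟩ := isConj_iff.1 hgh
  have := congrArg (fun y => y.coeff (c * g)) (hx (MonoidAlgebra.single c 1))
  simpa [mul_assoc] using this

theorem card_cellsOfRowLens (w : List ℕ) : (YoungDiagram.cellsOfRowLens w).card = w.sum := by
  induction w with
  | nil => rfl
  | cons a w ih =>
    rw [YoungDiagram.cellsOfRowLens, Finset.card_union_of_disjoint, Finset.card_map, ih]
    · simp
    · rw [Finset.disjoint_left]
      rintro ⟨i, j⟩ h1 h2
      simp only [Finset.mem_product, Finset.mem_singleton] at h1
      simp only [Finset.mem_map] at h2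
      obtain ⟨⟨i', j'⟩, -, h⟩ := h2
      have : i' + 1 = i := congrArg Prod.fst h
      omega

/-- A partition is the list of row lengths of a diagram. The index `Fintype.card (Fin d)`, in place
of `d`, is the one carried by `Equiv.Perm.partition`. -/
theorem card_partition_le (d : ℕ) :
    Fintype.card (Fintype.card (Fin d)).Partition ≤ Fintype.card (Shape d) := by
  have hs : ∀ p : (Fintype.card (Fin d)).Partition, (p.parts.sort (· ≥ ·)).SortedGE := fun p =>
    (Multiset.pairwise_sort p.parts (· ≥ ·)).sortedGE
  have hpos : ∀ p : (Fintype.card (Fin d)).Partition, ∀ x ∈ p.parts.sort (· ≥ ·), 0 < x :=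
    fun p x hx => p.parts_pos (by simpa using hx)
  refine Fintype.card_le_of_injective (fun p => (⟨YoungDiagram.ofRowLens _ (hs p), ?_⟩ : Shape d))
    fun p q h => ?_
  · refine (card_cellsOfRowLens _).trans ?_
    rw [← Multiset.sum_coe, Multiset.sort_eq, p.parts_sum, Fintype.card_fin]
  · have h1 := congrArg (fun l : Shape d => l.1.rowLens) h
    simp only [YoungDiagram.rowLens_ofRowLens_eq_self (hpos _)] at h1
    refine Nat.Partition.ext ?_
    rw [← Multiset.sort_eq p.parts (· ≥ ·), h1, Multiset.sort_eq]

/-- Central elements are class functions, and cycle type determines the conjugacy class, so the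
dimension is at most the number of partitions. -/
theorem finrank_center_le (d : ℕ) : Module.finrank ℂ (center d) ≤ Fintype.card (Shape d) := by
  classical
  refine le_trans ?_ (card_partition_le d)
  rw [← Module.finrank_fintype_fun_eq_card ℂ]
  -- Only injectivity matters, so partitions not known to be cycle types may receive the value 0.
  let F : center d →ₗ[ℂ] ((Fintype.card (Fin d)).Partition → ℂ) :=
    { toFun := fun x p => if h : ∃ g : Equiv.Perm (Fin d), g.partition = p
        then x.1.coeff h.choose else 0
      map_add' := fun x y => funext fun p => by
        by_cases h : ∃ g : Equiv.Perm (Fin d), g.partition = p <;> simp [h]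
      map_smul' := fun r x => funext fun p => by
        by_cases h : ∃ g : Equiv.Perm (Fin d), g.partition = p <;> simp [h] }
  refine LinearMap.finrank_le_finrank_of_injective (f := F) ?_
  rw [← LinearMap.ker_eq_bot, LinearMap.ker_eq_bot']
  intro x hx
  refine Subtype.ext (MonoidAlgebra.coeff_injective (Finsupp.ext fun g => ?_))
  have h : ∃ g' : Equiv.Perm (Fin d), g'.partition = g.partition := ⟨g, rfl⟩
  have h1 := congrFun hx g.partition
  simp only [F, LinearMap.coe_mk, AddHom.coe_mk, dif_pos h, Pi.zero_apply] at h1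
  rw [coeff_eq_of_isConj x.2 (Equiv.Perm.partition_eq_of_isConj.2 h.choose_spec).symm, h1]
  rfl

/-- One independent central idempotent per shape, in a space of dimension at most the number of
shapes, gives a basis. This is where completeness of the list of shapes enters. -/
theorem exists_eq_sum_cent {x : GA d} (hx : x ∈ center d) :
    ∃ a : Shape d → ℂ, x = ∑ l, a l • cent l := by
  let c : Shape d → center d := fun l => ⟨cent l, fun y => cent_comm l y⟩
  have hc : LinearIndependent ℂ c :=
    LinearIndependent.of_comp (center d).subtype linearIndependent_cent
  have hcard : Fintype.card (Shape d) = Module.finrank ℂ (center d) :=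
    le_antisymm hc.fintype_card_le_finrank (finrank_center_le d)
  have htop := hc.span_eq_top_of_card_eq_finrank' hcard
  have hmem : (⟨x, hx⟩ : center d) ∈ Submodule.span ℂ (Set.range c) := htop ▸ Submodule.mem_top
  obtain ⟨a, ha⟩ := (Submodule.mem_span_range_iff_exists_fun ℂ).1 hmem
  refine ⟨a, ?_⟩
  have := congrArg Subtype.val ha
  simpa [c] using this.symm

theorem sum_cent : ∑ l : Shape d, cent l = 1 := by
  obtain ⟨a, ha⟩ := exists_eq_sum_cent (x := (1 : GA d)) (fun y => by simp)
  have h1 : ∀ m, a m = 1 := fun m => by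
    have h := sum_smul_cent_mul_cent a m
    rw [← ha, one_mul] at h
    have h2 : (1 - a m) • cent m = 0 := by rw [sub_smul, ← h, one_smul, sub_self]
    exact (sub_eq_zero.1 ((smul_eq_zero.1 h2).resolve_right (cent_ne_zero m))).symm
  rw [ha]
  simp [h1]

end CharExp

end

noncomputable section

namespace CharExp

/-! ### Triangularization -/

/-- For an eigenvalue μ the range of f - μ is proper, hence lies in a hyperplane ker φ, which is
f-invariant. A basis of the hyperplane from the induction, preceded by a vector outside it, is lower
triangular. -/
theorem exists_triangular_basis (n : ℕ) {E : Type} [AddCommGroup E] [Module ℂ E]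
    [FiniteDimensional ℂ E] (hn : Module.finrank ℂ E = n) (f : E →ₗ[ℂ] E) :
    ∃ b : Module.Basis (Fin n) ℂ E, ∀ i j, i < j → b.repr (f (b j)) i = 0 := by
  induction n generalizing E with
  | zero => exact ⟨Module.finBasisOfFinrankEq ℂ E hn, fun i => i.elim0⟩
  | succ n ih =>
    have : Nontrivial E := Module.nontrivial_of_finrank_pos (R := ℂ) (by omega)
    obtain ⟨μ, hμ⟩ := Module.End.exists_eigenvalue (K := ℂ) f
    obtain ⟨v, hv⟩ := hμ.exists_hasEigenvector
    let fμ : E →ₗ[ℂ] E := f - μ • LinearMap.id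
    have hfμ : ∀ x, fμ x = f x - μ • x := fun x => rfl
    have hr : LinearMap.range fμ < ⊤ := by
      rw [lt_top_iff_ne_top]
      intro h
      have hinj := LinearMap.injective_iff_surjective.2 (LinearMap.range_eq_top.1 h)
      have h0 : fμ v = 0 := by
        rw [hfμ, hv.apply_eq_smul, sub_self]
      exact hv.2 (hinj (h0.trans (map_zero _).symm))
    obtain ⟨φ, hφ, hle⟩ := Submodule.exists_le_ker_of_lt_top _ hr
    have hfx : ∀ x, φ (f x) = μ * φ x := fun x => by
      have h1 : fμ x ∈ LinearMap.ker φ := hle ⟨x, rfl⟩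
      rw [LinearMap.mem_ker, hfμ] at h1
      simpa [sub_eq_zero] using h1
    have hinv : ∀ x ∈ LinearMap.ker φ, f x ∈ LinearMap.ker φ := fun x hx => by
      rw [LinearMap.mem_ker] at hx ⊢
      rw [hfx, hx, mul_zero]
    have hdim := Module.Dual.finrank_ker_add_one_of_ne_zero (f := φ) hφ
    obtain ⟨b, hb⟩ := ih (E := LinearMap.ker φ) (by omega) (f.restrict hinv)
    obtain ⟨y, hy⟩ : ∃ y, φ y ≠ 0 := by
      by_contra! h
      exact hφ (LinearMap.ext h)
    let B := Module.Basis.mkFinCons y b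
      (fun c x hx h => by
        have h1 := congrArg φ h
        rw [LinearMap.mem_ker] at hx
        simpa [hx, hy] using h1)
      (fun z => ⟨-(φ z / φ y), by
        rw [LinearMap.mem_ker]
        simp [hy]⟩)
    have hB0 : B 0 = y := by simp [B]
    have hBs : ∀ i : Fin n, B i.succ = b i := fun i => by simp [B]
    have hrepr : ∀ x : LinearMap.ker φ, B.repr x.1 =
        ∑ i, Finsupp.single i.succ (b.repr x i) := fun x => by
      conv_lhs => rw [← b.sum_repr x]
      rw [Submodule.coe_sum, map_sum]
      refine Finset.sum_congr rfl fun i _ => ?_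
      rw [Submodule.coe_smul, ← hBs, map_smul, B.repr_self]
      simp
    refine ⟨B, fun i j hij => ?_⟩
    cases j using Fin.cases with
    | zero => exact absurd hij (Fin.not_lt_zero i)
    | succ j =>
      have h1 : f (B j.succ) = ((f.restrict hinv (b j) : LinearMap.ker φ) : E) := by
        rw [hBs]; rfl
      rw [h1, hrepr]
      simp only [Finsupp.coe_finsetSum, Finset.sum_apply]
      refine Finset.sum_eq_zero fun k _ => ?_
      by_cases hk : k.succ = i
      · subst hk
        simpa using hb k j (by simpa using hij)
      · rw [Finsupp.single_eq_of_ne' hk]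

theorem roots_charpoly_of_triangular {N : ℕ} {T : Matrix (Fin N) (Fin N) ℂ}
    (hT : ∀ i j, i < j → T i j = 0) :
    T.charpoly.roots = Finset.univ.val.map fun i => T i i := by
  have h1 : T.charpoly = ∏ i, (Polynomial.X - Polynomial.C (T i i)) := by
    rw [Matrix.charpoly, Matrix.det_of_isLowerTriangular]
    · simp [Matrix.charmatrix_apply_eq]
    · intro i j hij
      have hij' : i < j := hij
      rw [Matrix.charmatrix_apply_ne _ _ _ hij'.ne, hT i j hij']
      simp
  rw [h1, Polynomial.roots_prod _ _ (by
    simp [Finset.prod_ne_zero_iff, Polynomial.X_sub_C_ne_zero])]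
  simp

theorem exists_triangular {N : ℕ} (B : Matrix (Fin N) (Fin N) ℂ) :
    ∃ P Q T : Matrix (Fin N) (Fin N) ℂ, Q * P = 1 ∧ B = P * T * Q ∧
      (∀ i j, i < j → T i j = 0) ∧ T.charpoly = B.charpoly := by
  obtain ⟨b, hb⟩ := exists_triangular_basis N (by simp) (Matrix.toLin' B)
  let e := Pi.basisFun ℂ (Fin N)
  refine ⟨e.toMatrix b, b.toMatrix e, LinearMap.toMatrix b b (Matrix.toLin' B),
    b.toMatrix_mul_toMatrix_flip e, ?_, ?_, ?_⟩
  · rw [basis_toMatrix_mul_linearMap_toMatrix_mul_basis_toMatrix]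
    exact (LinearMap.toMatrix'_toLin' B).symm
  · intro i j hij
    rw [LinearMap.toMatrix_apply]
    exact hb i j hij
  · rw [LinearMap.charpoly_toMatrix, ← LinearMap.charpoly_toMatrix _ e]
    exact congrArg _ (LinearMap.toMatrix'_toLin' B)

/-! ### Sums over functions constant on cycles -/

section Cycles

variable {d N : ℕ} (g : Equiv.Perm (Fin d))

/-- The set of cycles of a permutation, fixed points included. -/
abbrev Cycles : Type := g.cycleFactorsFinset ⊕ {k : Fin d // k ∉ g.support}

/-- The cycle through an element. -/
def toCycle (k : Fin d) : Cycles g :=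
  if h : k ∈ g.support then
    Sum.inl ⟨g.cycleOf k, Equiv.Perm.cycleOf_mem_cycleFactorsFinset_iff.2 h⟩
  else Sum.inr ⟨k, h⟩

theorem toCycle_eq_inl {k : Fin d} {c : g.cycleFactorsFinset} :
    toCycle g k = Sum.inl c ↔ k ∈ c.1.support := by
  rw [← Equiv.Perm.eq_cycleOf_of_mem_cycleFactorsFinset_iff g c.1 c.2 k, toCycle]
  split_ifs with h
  · simp [Subtype.ext_iff, eq_comm]
  · simp only [false_iff]
    intro hc
    exact h (Equiv.Perm.cycleOf_mem_cycleFactorsFinset_iff.1 (hc ▸ c.2))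

theorem toCycle_eq_inr {k : Fin d} {c : {k : Fin d // k ∉ g.support}} :
    toCycle g k = Sum.inr c ↔ k = c.1 := by
  rw [toCycle]
  split_ifs with h
  · simp only [false_iff]
    rintro rfl
    exact c.2 h
  · simp [Subtype.ext_iff]

theorem toCycle_surjective : Function.Surjective (toCycle g) := by
  rintro (c | c)
  · obtain ⟨x, hx⟩ := (Equiv.Perm.mem_cycleFactorsFinset_iff.1 c.2).1.nonempty_support
    exact ⟨x, (toCycle_eq_inl g).2 hx⟩
  · exact ⟨c.1, (toCycle_eq_inr g).2 rfl⟩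

theorem toCycle_apply (k : Fin d) : toCycle g (g k) = toCycle g k := by
  by_cases h : k ∈ g.support
  · have h' : g k ∈ g.support := Equiv.Perm.apply_mem_support.2 h
    have : g.cycleOf (g k) = g.cycleOf k := Equiv.Perm.cycleOf_self_apply g k
    simp only [toCycle, dif_pos h, dif_pos h', this]
  · rw [Equiv.Perm.notMem_support.1 h]

theorem sameCycle_of_toCycle_eq {k k' : Fin d} (h : toCycle g k = toCycle g k') :
    g.SameCycle k k' := by
  by_cases hk : k ∈ g.support
  · by_cases hk' : k' ∈ g.support
    · simp only [toCycle, dif_pos hk, dif_pos hk', Sum.inl.injEq, Subtype.mk.injEq] at h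
      exact (Equiv.Perm.sameCycle_iff_cycleOf_eq_of_mem_support hk hk').2 h
    · rw [toCycle, toCycle, dif_pos hk, dif_neg hk'] at h
      exact (Sum.inl_ne_inr h).elim
  · by_cases hk' : k' ∈ g.support
    · rw [toCycle, toCycle, dif_neg hk, dif_pos hk'] at h
      exact (Sum.inr_ne_inl h).elim
    · simp only [toCycle, dif_neg hk, dif_neg hk', Sum.inr.injEq, Subtype.mk.injEq] at h
      rw [h]

theorem eq_of_sameCycle {α : Type*} {J : Fin d → α} (hJ : ∀ k, J (g k) = J k) {k k' : Fin d}
    (h : g.SameCycle k k') : J k = J k' := by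
  obtain ⟨n, -, -, rfl⟩ := h.exists_pow_eq
  induction n with
  | zero => rfl
  | succ n ih =>
    rw [pow_succ', Equiv.Perm.mul_apply, hJ]
    exact ih ⟨n, by simp⟩

/-- Invariant index functions are exactly the functions on the set of cycles; expanding the product
over cycles lists them. -/
theorem sum_invariant (t : Fin N → ℂ) :
    ∑ J : Fin d → Fin N with ∀ k, J (g k) = J k, ∏ k, t (J k) =
      ∏ c : Cycles g, ∑ j, t j ^ (Finset.univ.filter fun k => toCycle g k = c).card := by
  rw [Finset.prod_univ_sum, Fintype.piFinset_univ]
  symm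
  refine Finset.sum_bij (fun F _ => F ∘ toCycle g) ?_ ?_ ?_ ?_
  · intro F _
    simp [toCycle_apply]
  · intro F _ F' _ h
    exact (toCycle_surjective g).injective_comp_right h
  · intro J hJ
    rw [Finset.mem_filter] at hJ
    refine ⟨J ∘ Function.surjInv (toCycle_surjective g), Finset.mem_univ _, funext fun k => ?_⟩
    exact eq_of_sameCycle g hJ.2
      (sameCycle_of_toCycle_eq g (Function.surjInv_eq (toCycle_surjective g) _))
  · intro F _
    rw [← Finset.prod_fiberwise _ (toCycle g)]
    refine Finset.prod_congr rfl fun c _ => ?_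
    rw [← Finset.prod_const]
    refine Finset.prod_congr rfl fun k hk => ?_
    rw [Function.comp_apply, (Finset.mem_filter.1 hk).2]

theorem sum_invariant_eq_psumPart (t : Fin N → ℂ) :
    ∑ J : Fin d → Fin N with ∀ k, J (g k) = J k, ∏ k, t (J k) =
      MvPolynomial.eval t (MvPolynomial.psumPart (Fin N) ℂ g.partition) := by
  have hinl : ∀ c : g.cycleFactorsFinset,
      (Finset.univ.filter fun k => toCycle g k = Sum.inl c) = c.1.support := fun c => by
    ext k
    simp only [Finset.mem_filter, Finset.mem_univ, true_and, toCycle_eq_inl]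
  have hinr : ∀ c : {k : Fin d // k ∉ g.support},
      (Finset.univ.filter fun k => toCycle g k = Sum.inr c) = {c.1} := fun c => by
    ext k
    simp only [Finset.mem_filter, Finset.mem_univ, true_and, toCycle_eq_inr, Finset.mem_singleton]
  have heval : ∀ m, MvPolynomial.eval t (MvPolynomial.psum (Fin N) ℂ m) = ∑ j, t j ^ m :=
    fun m => by simp [MvPolynomial.psum]
  have hcard : Fintype.card {k : Fin d // k ∉ g.support} = Fintype.card (Fin d) - g.support.card := by
    rw [Fintype.card_subtype_compl, Fintype.card_coe]
  -- The partition of `g` is the cycle type together with a part 1 for each fixed point, matching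
  -- the two summands of `Cycles g`.
  rw [sum_invariant, Fintype.prod_sum_type, MvPolynomial.psumPart, Equiv.Perm.parts_partition,
    Multiset.map_add, Multiset.prod_add, map_mul, Multiset.map_replicate, Multiset.prod_replicate,
    map_pow, heval, ← hcard]
  congr 1
  · simp only [hinl]
    rw [map_multiset_prod, Multiset.map_map, Equiv.Perm.cycleType_def, Multiset.map_map,
      Finset.prod_coe_sort g.cycleFactorsFinset fun c => ∑ j, t j ^ c.support.card,
      Finset.prod]
    congr 1
    refine Multiset.map_congr rfl fun c _ => ?_
    simp [heval]
  · simp [hinr]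

end Cycles

/-- Needed because the diagonal of a triangular form lists the eigenvalues in an order of its own.
-/
theorem eval_psumPart_congr {N n : ℕ} {a b : Fin N → ℂ}
    (h : Finset.univ.val.map a = Finset.univ.val.map b) (μ : n.Partition) :
    MvPolynomial.eval a (MvPolynomial.psumPart (Fin N) ℂ μ) =
      MvPolynomial.eval b (MvPolynomial.psumPart (Fin N) ℂ μ) := by
  have heval : ∀ m, MvPolynomial.eval a (MvPolynomial.psum (Fin N) ℂ m) =
      MvPolynomial.eval b (MvPolynomial.psum (Fin N) ℂ m) := fun m => by
    have h1 := congrArg (fun s => (s.map (· ^ m)).sum) h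
    simp only [Multiset.map_map] at h1
    simp only [MvPolynomial.psum, map_sum, map_pow, MvPolynomial.eval_X]
    exact h1
  rw [MvPolynomial.psumPart, map_multiset_prod, map_multiset_prod, Multiset.map_map,
    Multiset.map_map]
  congr 1
  exact Multiset.map_congr rfl fun m _ => heval m

end CharExp

end

noncomputable section

namespace CharExp

/-! ### Matrices on the tensor power -/

/-- The standard basis of the tensor power. -/
def tensorBasis (N d : ℕ) : Module.Basis (Fin d → Fin N) ℂ (TensorPow N d) :=
  Basis.piTensorProduct fun _ => Pi.basisFun ℂ (Fin N)

/-- Square matrices indexed by the standard basis of the tensor power. -/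
abbrev TMat (N d : ℕ) : Type := Matrix (Fin d → Fin N) (Fin d → Fin N) ℂ

/-- The action of the group algebra on tensors, in the standard basis. -/
def rho (N d : ℕ) : GA d →ₐ[ℂ] TMat N d :=
  (LinearMap.toMatrixAlgEquiv (tensorBasis N d)).toAlgHom.comp (permRep N d).asAlgebraHom

/-- The `d`-th tensor power of a matrix. -/
def kron {N : ℕ} (d : ℕ) (X : Matrix (Fin N) (Fin N) ℂ) : TMat N d :=
  Matrix.of fun J L => ∏ k, X (J k) (L k)

variable {N d : ℕ}

theorem kron_apply (X : Matrix (Fin N) (Fin N) ℂ) (J L : Fin d → Fin N) :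
    kron d X J L = ∏ k, X (J k) (L k) := rfl

theorem rho_single_apply (g : Equiv.Perm (Fin d)) (J L : Fin d → Fin N) :
    rho N d (MonoidAlgebra.single g 1) J L = if L = J ∘ g then 1 else 0 := by
  have h1 : rho N d (MonoidAlgebra.single g 1) =
      LinearMap.toMatrix (tensorBasis N d) (tensorBasis N d) (permRep N d g) := by
    change LinearMap.toMatrix _ _ ((permRep N d).asAlgebraHom (MonoidAlgebra.single g 1)) = _
    rw [Representation.asAlgebraHom_single_one]
  have h2 : permRep N d g (tensorBasis N d L) = tensorBasis N d (L ∘ g.symm) := by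
    simp only [tensorBasis, Basis.piTensorProduct_apply]
    exact PiTensorProduct.reindex_tprod _ _
  rw [h1, LinearMap.toMatrix_apply, h2, Module.Basis.repr_self, Finsupp.single_apply]
  have h3 : L ∘ g.symm = J ↔ L = J ∘ g := by
    constructor
    · rintro rfl; ext; simp
    · rintro rfl; ext; simp
  simp only [h3]

theorem rho_single_mul (g : Equiv.Perm (Fin d)) (M : TMat N d) (J L : Fin d → Fin N) :
    (rho N d (MonoidAlgebra.single g 1) * M) J L = M (J ∘ g) L := by
  simp [Matrix.mul_apply, rho_single_apply]

theorem mul_rho_single (g : Equiv.Perm (Fin d)) (M : TMat N d) (J L : Fin d → Fin N) :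
    (M * rho N d (MonoidAlgebra.single g 1)) J L = M J (L ∘ g.symm) := by
  have h3 : ∀ x : Fin d → Fin N, L = x ∘ g ↔ L ∘ g.symm = x := fun x => by
    constructor
    · rintro rfl; ext; simp
    · rintro rfl; ext; simp
  simp [Matrix.mul_apply, rho_single_apply, h3]

theorem kron_mul (X Y : Matrix (Fin N) (Fin N) ℂ) : kron d (X * Y) = kron d X * kron d Y := by
  ext J L
  simp only [kron_apply, Matrix.mul_apply, Finset.prod_univ_sum, Fintype.piFinset_univ,
    Finset.prod_mul_distrib]

theorem kron_one : kron d (1 : Matrix (Fin N) (Fin N) ℂ) = 1 := by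
  ext J L
  simp [kron_apply, Matrix.one_apply, Fintype.prod_ite_zero, funext_iff]

theorem trace_kron (X : Matrix (Fin N) (Fin N) ℂ) : (kron d X).trace = X.trace ^ d := by
  have h := Finset.prod_univ_sum (fun _ : Fin d => (Finset.univ : Finset (Fin N)))
    (fun _ i => X i i)
  rw [Fintype.piFinset_univ] at h
  simp only [Matrix.trace, Matrix.diag_apply, kron_apply]
  rw [← h]
  simp

theorem rho_single_mul_kron (g : Equiv.Perm (Fin d)) (X : Matrix (Fin N) (Fin N) ℂ) :
    rho N d (MonoidAlgebra.single g 1) * kron d X =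
      kron d X * rho N d (MonoidAlgebra.single g 1) := by
  ext J L
  rw [rho_single_mul, mul_rho_single, kron_apply, kron_apply]
  exact Fintype.prod_equiv g _ _ fun k => by simp

theorem rho_mul_kron (x : GA d) (X : Matrix (Fin N) (Fin N) ℂ) :
    rho N d x * kron d X = kron d X * rho N d x := by
  induction x using MonoidAlgebra.induction_on with
  | of g => exact rho_single_mul_kron g X
  | add a b ha hb => rw [map_add, add_mul, mul_add, ha, hb]
  | smul r a ha => rw [map_smul, smul_mul_assoc, mul_smul_comm, ha]

theorem trace_rho_single_mul_kron (g : Equiv.Perm (Fin d)) (X : Matrix (Fin N) (Fin N) ℂ) :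
    (rho N d (MonoidAlgebra.single g 1) * kron d X).trace =
      ∑ J : Fin d → Fin N, ∏ k, X (J (g k)) (J k) := by
  simp only [Matrix.trace, Matrix.diag_apply, rho_single_mul, kron_apply, Function.comp_apply]

/-- The trace of a permutation times a tensor power is the power sum of the cycle type, evaluated
at the eigenvalues. -/
theorem trace_rho_single_mul_kron_eq (g : Equiv.Perm (Fin d)) {B : Matrix (Fin N) (Fin N) ℂ}
    {b : Fin N → ℂ} (hb : AreEigenvalues B b) :
    (rho N d (MonoidAlgebra.single g 1) * kron d B).trace =
      MvPolynomial.eval b (MvPolynomial.psumPart (Fin N) ℂ g.partition) := by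
  obtain ⟨P, Q, T, hQP, rfl, hT, hch⟩ := exists_triangular B
  rw [AreEigenvalues, ← hch, roots_charpoly_of_triangular hT] at hb
  rw [← eval_psumPart_congr hb, ← sum_invariant_eq_psumPart, kron_mul, kron_mul, ← mul_assoc,
    ← mul_assoc, rho_single_mul_kron, mul_assoc, Matrix.trace_mul_comm, mul_assoc, ← mul_assoc,
    mul_assoc, ← mul_assoc (kron d Q), ← kron_mul, hQP, kron_one, one_mul,
    ← rho_single_mul_kron, trace_rho_single_mul_kron, Finset.sum_filter]
  refine Finset.sum_congr rfl fun J _ => ?_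
  split_ifs with h
  · exact Finset.prod_congr rfl fun k _ => by rw [h]
  · push Not at h
    by_contra hne
    -- A nonzero term of a lower triangular matrix forces J ≤ J ∘ g pointwise. Both sides have the
    -- same sum over k, so J is g-invariant; the other terms vanish.
    have hle : ∀ k ∈ Finset.univ, (J k : ℕ) ≤ J (g k) := fun k _ => by
      by_contra hlt
      refine hne (Finset.prod_eq_zero (Finset.mem_univ k) (hT _ _ ?_))
      exact Fin.lt_def.2 (not_le.1 hlt)
    obtain ⟨k, hk⟩ := h
    have hsum : ∑ k, (J k : ℕ) = ∑ k, (J (g k) : ℕ) :=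
      (Equiv.sum_comp g fun k => (J k : ℕ)).symm
    exact hk (Fin.ext ((Finset.sum_eq_sum_iff_of_le hle).1 hsum k (Finset.mem_univ k)).symm)

/-! ### Traces of the idempotents -/

theorem trace_rho (x : GA d) : (rho N d x).trace =
    LinearMap.trace ℂ (TensorPow N d) ((permRep N d).asAlgebraHom x) := by
  rw [LinearMap.trace_eq_matrix_trace ℂ (tensorBasis N d)]
  rfl

theorem rho_eq_zero_iff (x : GA d) : rho N d x = 0 ↔ (permRep N d).asAlgebraHom x = 0 :=
  (LinearMap.toMatrixAlgEquiv (tensorBasis N d)).map_eq_zero_iff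

instance : FiniteDimensional ℂ (TensorPow N d) := (tensorBasis N d).finiteDimensional_of_finite

theorem dimW_eq_finrank (l : Shape d) : dimW N l.1 =
    Module.finrank ℂ (LinearMap.range ((permRep N d).asAlgebraHom (idem l))) := by
  obtain ⟨lam, rfl⟩ := l
  rw [dimW]
  change Module.finrank ℂ (LinearMap.range ((permRep N lam.card).asAlgebraHom
    (sym (⟨lam, rfl⟩ : Shape lam.card)))) = _
  rw [sym_eq_smul_idem, map_smul, LinearMap.range_smul _ _ (kap_ne_zero _)]

theorem trace_eq_finrank_range {E : Type*} [AddCommGroup E] [Module ℂ E] [FiniteDimensional ℂ E]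
    {f : E →ₗ[ℂ] E} (h : IsIdempotentElem f) :
    LinearMap.trace ℂ E f = Module.finrank ℂ (LinearMap.range f) :=
  (LinearMap.IsIdempotentElem.isProj_range f h).trace

theorem trace_rho_idem (l : Shape d) : (rho N d (idem l)).trace = dimW N l.1 := by
  have h : IsIdempotentElem ((permRep N d).asAlgebraHom (idem l)) := by
    rw [IsIdempotentElem, ← map_mul, idem_mul_idem]
  rw [trace_rho, dimW_eq_finrank]
  exact trace_eq_finrank_range h

theorem rho_idem_eq_zero {l : Shape d} (h : dimW N l.1 = 0) : rho N d (idem l) = 0 := by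
  rw [dimW_eq_finrank, Submodule.finrank_eq_zero, LinearMap.range_eq_bot] at h
  exact (rho_eq_zero_iff _).2 h

theorem rho_cent_eq_zero {l : Shape d} (h : dimW N l.1 = 0) : rho N d (cent l) = 0 := by
  simp [cent, classSum, rho_idem_eq_zero h]

/-- Permutations commute with tensor powers, so all d! conjugates of the idempotent have the same
trace. -/
theorem trace_rho_classSum_mul_kron (l : Shape d) (X : Matrix (Fin N) (Fin N) ℂ) :
    (rho N d (classSum l) * kron d X).trace =
      d.factorial * (rho N d (idem l) * kron d X).trace := by
  have h : ∀ g : Equiv.Perm (Fin d), (rho N d (MonoidAlgebra.single g 1 * idem l *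
      MonoidAlgebra.single g⁻¹ 1) * kron d X).trace = (rho N d (idem l) * kron d X).trace := by
    intro g
    rw [map_mul, mul_assoc, rho_single_mul_kron, map_mul, Matrix.trace_mul_comm, mul_assoc,
      ← mul_assoc (rho N d (MonoidAlgebra.single g⁻¹ 1)), ← map_mul,
      MonoidAlgebra.single_mul_single, inv_mul_cancel, mul_one, ← MonoidAlgebra.one_def, map_one,
      one_mul, Matrix.trace_mul_comm]
  rw [classSum, map_sum, Finset.sum_mul, Matrix.trace_sum, Finset.sum_congr rfl fun g _ => h g]
  simp [Fintype.card_perm]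

theorem trace_rho_cent (l : Shape d) :
    (rho N d (cent l)).trace = dimV l.1 * dimW N l.1 := by
  have h := trace_rho_classSum_mul_kron l (1 : Matrix (Fin N) (Fin N) ℂ)
  rw [kron_one, mul_one, mul_one, trace_rho_idem] at h
  rw [cent, map_smul, Matrix.trace_smul, h, dimV_eq, smul_eq_mul]
  ring

/-- This is the trace of the resolution of the identity on tensors; every growth estimate below
depends on it. -/
theorem sum_dimV_mul_dimW (N d : ℕ) : ∑ l : Shape d, dimV l.1 * dimW N l.1 = N ^ d := by
  have h := congrArg (fun x => (rho N d x).trace) (sum_cent (d := d))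
  simp only [map_sum, Matrix.trace_sum, trace_rho_cent, map_one, Matrix.trace_one] at h
  rw [Fintype.card_fun, Fintype.card_fin, Fintype.card_fin] at h
  exact_mod_cast h

theorem dimV_pos (l : Shape d) : 0 < dimV l.1 := by
  have h : (dimV l.1 : ℂ) ≠ 0 := by
    rw [dimV_eq]
    exact mul_ne_zero (by exact_mod_cast d.factorial_ne_zero) (inv_ne_zero (kap_ne_zero l))
  exact Nat.pos_of_ne_zero (by exact_mod_cast h)

/-- The Schur polynomial at the eigenvalues is a trace on the tensor power. -/
theorem eval_schur (l : Shape d) {B : Matrix (Fin N) (Fin N) ℂ} {b : Fin N → ℂ}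
    (hb : AreEigenvalues B b) :
    MvPolynomial.eval b (schur N l.1) =
      (d.factorial : ℂ)⁻¹ * (rho N d (classSum l) * kron d B).trace := by
  obtain ⟨lam, rfl⟩ := l
  have hinv : ∀ g : Equiv.Perm (Fin lam.card), g⁻¹.partition = g.partition := fun g => by
    refine Equiv.Perm.partition_eq_of_isConj.1 ?_
    rw [Equiv.Perm.isConj_iff_cycleType_eq, Equiv.Perm.cycleType_inv]
  rw [schur, groupAlgebra_eq_sum (classSum _), map_mul, MvPolynomial.eval_C, map_sum, map_sum,
    Finset.sum_mul, Matrix.trace_sum]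
  congr 1
  -- The class sum carries χ(g⁻¹) at g; inversion fixes cycle types, so the power sums are
  -- unaffected.
  refine Fintype.sum_equiv (Equiv.inv _) _ _ fun g => ?_
  rw [map_smul, smul_mul_assoc, Matrix.trace_smul, trace_rho_single_mul_kron_eq _ hb,
    classSum_coeff, map_mul, MvPolynomial.eval_C, character_Vrep, Equiv.inv_apply, inv_inv, hinv,
    smul_eq_mul]

theorem trace_rho_cent_mul_kron (l : Shape d) {B : Matrix (Fin N) (Fin N) ℂ} {b : Fin N → ℂ}
    (hb : AreEigenvalues B b) :
    (rho N d (cent l) * kron d B).trace = dimV l.1 * MvPolynomial.eval b (schur N l.1) := by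
  have hd : (d.factorial : ℂ) ≠ 0 := by exact_mod_cast d.factorial_ne_zero
  rw [eval_schur l hb, dimV_eq, cent, map_smul, smul_mul_assoc, Matrix.trace_smul, smul_eq_mul]
  field_simp

/-- A diagram with more than `N` rows does not occur in the tensor powers of `ℂ^N`. -/
theorem dimW_eq_zero {l : Shape d} (h : N < numRows l.1) : dimW N l.1 = 0 := by
  obtain ⟨lam, rfl⟩ := l
  set t := numbering lam
  have hcol : ∀ (J L : Fin lam.card → Fin N), rho N _ (colSum t) J L = 0 := by
    intro J L
    have hmem : ∀ i : Fin (numRows lam), (i.1, 0) ∈ lam.cells := fun i =>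
      (YoungDiagram.mem_cells _).2 (YoungDiagram.mem_iff_lt_colLen.2 i.2)
    -- The first column has more than `N` cells, so two of its entries carry the same basis vector,
    -- and antisymmetry in them kills the tensor.
    obtain ⟨i, i', hne, hii⟩ := Fintype.exists_ne_map_eq_of_card_lt
      (fun i : Fin (numRows lam) => L (t ⟨(i.1, 0), hmem i⟩)) (by simpa using h)
    set e := t ⟨(i.1, 0), hmem i⟩
    set e' := t ⟨(i'.1, 0), hmem i'⟩
    have hee : e ≠ e' := fun he => hne (by
      have := congrArg (fun c => c.1.1) (t.injective he)
      exact Fin.ext this)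
    have hc : colOf t e = colOf t e' := by simp [colOf, e, e']
    have h1 := congrArg (rho N _) (colSum_mul_single (swap_mem_colPerms hc))
    have h2 := congrFun (congrFun h1 J) L
    rw [map_mul, mul_rho_single, Equiv.Perm.sign_swap hee] at h2
    have h3 : L ∘ (Equiv.swap e e').symm = L := by
      funext x
      rw [Function.comp_apply, Equiv.symm_swap, Equiv.swap_apply_def]
      split_ifs with h1 h2
      · rw [h1]; exact hii.symm
      · rw [h2]; exact hii
      · rfl
    rw [h3] at h2
    simp at h2
    exact self_eq_neg.1 h2
  have h0 : rho N lam.card (idem ⟨lam, rfl⟩) = 0 := by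
    rw [idem, sym_mk, youngSymmetrizer_eq, map_smul, map_mul,
      show rho N _ (colSum t) = 0 from Matrix.ext hcol, mul_zero, smul_zero]
  have := trace_rho_idem (N := N) (⟨lam, rfl⟩ : Shape lam.card)
  rw [h0, Matrix.trace_zero] at this
  exact_mod_cast this.symm

end CharExp

end

noncomputable section

namespace CharExp

variable {N d : ℕ}

/-! ### The bicommutant of the symmetric group -/

/-- A matrix commuting with the commutant of the symmetric group lies in the image of the group
algebra. -/
theorem exists_rho_eq (D : TMat N d)
    (hD : ∀ C : TMat N d, (∀ g, rho N d (MonoidAlgebra.single g 1) * C =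
      C * rho N d (MonoidAlgebra.single g 1)) → D * C = C * D) :
    ∃ x, rho N d x = D := by
  let S : Submodule ℂ (TMat N d) := LinearMap.range (rho N d).toLinearMap
  obtain ⟨p, hp⟩ := S.subtype.exists_leftInverse_of_injective S.ker_subtype
  have hp' : ∀ s : S, p s.1 = s := fun s => LinearMap.congr_fun hp s
  let r : Equiv.Perm (Fin d) → TMat N d := fun g => rho N d (MonoidAlgebra.single g 1)
  have hr : ∀ g h, r (g * h) = r g * r h := fun g h => by
    simp only [r]
    rw [← map_mul, MonoidAlgebra.single_mul_single, one_mul]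
  have hr1 : r 1 = 1 := map_one (rho N d)
  -- Maschke averaging of a linear projection `p` onto the image `S`: an equivariant map into `S`.
  -- It is not normalised, so it acts on `S` as d!.
  let π : TMat N d →ₗ[ℂ] TMat N d :=
    ∑ g, LinearMap.mulLeft ℂ (r g) ∘ₗ S.subtype ∘ₗ p ∘ₗ LinearMap.mulLeft ℂ (r g⁻¹)
  have hπ : ∀ X, π X = ∑ g, r g * (p (r g⁻¹ * X)).1 := fun X => by
    simp [π, LinearMap.sum_apply]
  have hmemS : ∀ g, ∀ Y ∈ S, r g * Y ∈ S := by
    rintro g _ ⟨x, rfl⟩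
    exact ⟨MonoidAlgebra.single g 1 * x, map_mul (rho N d) _ _⟩
  have hmem : ∀ X, π X ∈ S := fun X => by
    rw [hπ]
    exact Submodule.sum_mem _ fun g _ => hmemS g _ (p _).2
  have hπS : ∀ X ∈ S, π X = (d.factorial : ℂ) • X := fun X hX => by
    have h1 : ∀ g, r g * (p (r g⁻¹ * X)).1 = X := fun g => by
      have h2 := hp' ⟨_, hmemS g⁻¹ X hX⟩
      simp only at h2
      rw [h2, ← mul_assoc, ← hr, mul_inv_cancel, hr1, one_mul]
    rw [hπ, Finset.sum_congr rfl fun g _ => h1 g]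
    simp [Fintype.card_perm, ← Nat.cast_smul_eq_nsmul ℂ]
  have hπr : ∀ h X, π (r h * X) = r h * π X := fun h X => by
    rw [hπ, hπ, Finset.mul_sum]
    refine (Fintype.sum_equiv (Equiv.mulLeft h) _ _ fun g => ?_).symm
    rw [Equiv.coe_mulLeft, ← mul_assoc, ← hr, mul_inv_rev, ← mul_assoc, ← hr,
      inv_mul_cancel_right]
  -- These are the blocks of `π` as an operator on matrices regarded as tuples of columns.
  -- Equivariance puts each block in the commutant of S(d), so `D` commutes with all of them and
  -- hence with `π`.
  let C : (Fin d → Fin N) → (Fin d → Fin N) → TMat N d := fun j l =>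
    Matrix.of fun i k => π (Matrix.single k j 1) i l
  have hC : ∀ X i l, π X i l = ∑ j, (C j l * X) i j := fun X i l => by
    conv_lhs => rw [Matrix.matrix_eq_sum_single X]
    simp only [map_sum, Matrix.sum_apply, Matrix.mul_apply]
    rw [Finset.sum_comm]
    refine Finset.sum_congr rfl fun j _ => Finset.sum_congr rfl fun k _ => ?_
    have : Matrix.single k j (X k j) = X k j • Matrix.single k j (1 : ℂ) := by simp
    rw [this, map_smul, Matrix.smul_apply, smul_eq_mul, mul_comm]
    rfl
  have hCr : ∀ j l g, r g * C j l = C j l * r g := fun j l g => by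
    ext i k
    have h1 : (r g * C j l) i k = (r g * π (Matrix.single k j 1)) i l := by
      simp only [Matrix.mul_apply, C, Matrix.of_apply]
    rw [h1, ← hπr, hC, Finset.sum_eq_single j]
    · rw [← mul_assoc]
      simp
    · intro j' _ hj
      rw [← mul_assoc, Matrix.mul_single_apply_of_ne _ _ _ _ _ hj]
    · simp
  have hDπ : ∀ X, π (D * X) = D * π X := fun X => by
    ext i l
    rw [hC, Matrix.mul_apply]
    simp only [hC, Finset.mul_sum]
    rw [Finset.sum_comm]
    refine Finset.sum_congr rfl fun j _ => ?_
    rw [← mul_assoc, ← hD _ (hCr j l), mul_assoc, Matrix.mul_apply]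
  have h1S : (1 : TMat N d) ∈ S := ⟨1, map_one (rho N d)⟩
  -- Since 1 lies in `S`, d! D = D π(1) = π(D), which lies in `S`.
  have hfin : (d.factorial : ℂ) • D ∈ S := by
    have h1 := hDπ 1
    rw [mul_one, hπS 1 h1S, mul_smul_comm, mul_one] at h1
    exact h1 ▸ hmem D
  have hd : (d.factorial : ℂ) ≠ 0 := by exact_mod_cast d.factorial_ne_zero
  exact (Submodule.smul_mem_iff S hd).1 hfin

/-! ### Polarization -/

/-- For bijective `f` every sign occurs twice. Otherwise some value is missed, and flipping the sign
there negates each term. -/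
theorem sum_signs_prod (f : Fin d → Fin d) :
    ∑ ε : Fin d → ℤˣ, ((∏ s, (ε s : ℤ) : ℤ) : ℂ) * ∏ k, ((ε (f k) : ℤ) : ℂ) =
      if Function.Bijective f then (2 : ℂ) ^ d else 0 := by
  split_ifs with hf
  · have h1 : ∀ ε : Fin d → ℤˣ,
        ((∏ s, (ε s : ℤ) : ℤ) : ℂ) * ∏ k, ((ε (f k) : ℤ) : ℂ) = 1 := fun ε => by
      rw [Function.Bijective.prod_comp hf fun s => ((ε s : ℤ) : ℂ), Int.cast_prod,
        ← Finset.prod_mul_distrib]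
      refine Finset.prod_eq_one fun s _ => ?_
      rcases Int.units_eq_one_or (ε s) with h | h <;> simp [h]
    rw [Finset.sum_congr rfl fun ε _ => h1 ε]
    simp
  · have hs : ¬ Function.Surjective f := fun h => hf ((Finite.surjective_iff_bijective).1 h)
    obtain ⟨s₀, hs₀⟩ := not_forall.1 hs
    push Not at hs₀
    let δ : Fin d → ℤˣ := Pi.mulSingle s₀ (-1)
    have hδ : ∀ s, s ≠ s₀ → δ s = 1 := fun s h => Pi.mulSingle_eq_of_ne h _
    have hprod : ∏ s, δ s = -1 := by
      rw [Fintype.prod_eq_single s₀ hδ]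
      exact Pi.mulSingle_eq_same s₀ _
    have h1 := Equiv.sum_comp (Equiv.mulRight δ) fun ε : Fin d → ℤˣ =>
      ((∏ s, (ε s : ℤ) : ℤ) : ℂ) * ∏ k, ((ε (f k) : ℤ) : ℂ)
    have h2 : ∀ ε : Fin d → ℤˣ, ((∏ s, (((Equiv.mulRight δ) ε) s : ℤ) : ℤ) : ℂ) *
        ∏ k, ((((Equiv.mulRight δ) ε) (f k) : ℤ) : ℂ) =
        -(((∏ s, (ε s : ℤ) : ℤ) : ℂ) * ∏ k, ((ε (f k) : ℤ) : ℂ)) := fun ε => by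
      have h3 : ∀ k, (Equiv.mulRight δ ε) (f k) = ε (f k) := fun k => by
        simp [hδ _ (hs₀ k)]
      have h4 : ∏ s, (((Equiv.mulRight δ) ε) s : ℤ) = -∏ s, (ε s : ℤ) := by
        have h5 : ∏ s, (Equiv.mulRight δ ε) s = -∏ s, ε s := by
          simp [Finset.prod_mul_distrib, hprod]
        have := congrArg (fun u : ℤˣ => (u : ℤ)) h5
        simpa using this
      simp only [h3, h4]
      push_cast
      ring
    rw [Finset.sum_congr rfl fun ε _ => h2 ε, Finset.sum_neg_distrib] at h1
    exact self_eq_neg.1 h1.symm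

/-- Polarization: after expanding the product over `k`, the sum over signs leaves only the bijective
choices. -/
theorem sum_perm_prod_eq_sum_signs (m : Fin d → Fin d → ℂ) :
    (2 : ℂ) ^ d * ∑ g : Equiv.Perm (Fin d), ∏ k, m k (g k) =
      ∑ ε : Fin d → ℤˣ, ((∏ s, (ε s : ℤ) : ℤ) : ℂ) * ∏ k, ∑ s, ((ε s : ℤ) : ℂ) * m k s := by
  have h1 : ∀ ε : Fin d → ℤˣ,
      ((∏ s, (ε s : ℤ) : ℤ) : ℂ) * ∏ k, ∑ s, ((ε s : ℤ) : ℂ) * m k s =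
      ∑ f : Fin d → Fin d, (((∏ s, (ε s : ℤ) : ℤ) : ℂ) * ∏ k, ((ε (f k) : ℤ) : ℂ)) *
        ∏ k, m k (f k) := fun ε => by
    rw [Finset.prod_univ_sum, Fintype.piFinset_univ, Finset.mul_sum]
    refine Finset.sum_congr rfl fun f _ => ?_
    rw [Finset.prod_mul_distrib, mul_assoc]
  rw [Finset.sum_congr rfl fun ε _ => h1 ε, Finset.sum_comm]
  simp only [← Finset.sum_mul, sum_signs_prod, ite_mul, zero_mul]
  rw [← Finset.sum_filter, ← Finset.mul_sum]
  congr 1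
  refine Finset.sum_bij (fun g _ => ⇑g) ?_ ?_ ?_ ?_
  · intro g _
    exact Finset.mem_filter.2 ⟨Finset.mem_univ _, g.bijective⟩
  · intro g _ h _ e
    exact DFunLike.coe_injective e
  · intro f hf
    exact ⟨Equiv.ofBijective f (Finset.mem_filter.1 hf).2, Finset.mem_univ _, rfl⟩
  · intros
    rfl

/-- Symmetrized matrix units `S a b` are, by polarization, combinations of tensor powers, so `D`
commutes with them. A matrix commuting with permutations is invariant under simultaneous permutation
of its indices, hence is a combination of the `S a b`. -/
theorem commute_of_commute_kron (D : TMat N d)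
    (hD : ∀ X : Matrix (Fin N) (Fin N) ℂ, D * kron d X = kron d X * D) (C : TMat N d)
    (hC : ∀ g, rho N d (MonoidAlgebra.single g 1) * C = C * rho N d (MonoidAlgebra.single g 1)) :
    D * C = C * D := by
  let S : (Fin d → Fin N) → (Fin d → Fin N) → TMat N d := fun a b =>
    Matrix.of fun J L => ∑ g : Equiv.Perm (Fin d),
      ∏ k, if a (g k) = J k ∧ b (g k) = L k then (1 : ℂ) else 0
  have hS : ∀ a b, (2 : ℂ) ^ d • S a b = ∑ ε : Fin d → ℤˣ, ((∏ s, (ε s : ℤ) : ℤ) : ℂ) •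
      kron d (Matrix.of fun i j => ∑ s, ((ε s : ℤ) : ℂ) *
        if a s = i ∧ b s = j then (1 : ℂ) else 0) := by
    intro a b
    ext J L
    rw [Matrix.smul_apply, smul_eq_mul, Matrix.sum_apply]
    exact sum_perm_prod_eq_sum_signs fun k s => if a s = J k ∧ b s = L k then (1 : ℂ) else 0
  have hDS : ∀ a b, D * S a b = S a b * D := by
    intro a b
    have h1 : D * ((2 : ℂ) ^ d • S a b) = ((2 : ℂ) ^ d • S a b) * D := by
      rw [hS, Finset.mul_sum, Finset.sum_mul]
      exact Finset.sum_congr rfl fun ε _ => by rw [mul_smul_comm, hD, smul_mul_assoc]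
    rw [mul_smul_comm, smul_mul_assoc] at h1
    exact smul_right_injective _ (pow_ne_zero d (two_ne_zero : (2 : ℂ) ≠ 0)) h1
  have hinv : ∀ (g : Equiv.Perm (Fin d)) J L, C (J ∘ g) (L ∘ g) = C J L := by
    intro g J L
    have h1 := congrFun (congrFun (hC g) J) (L ∘ g)
    rw [rho_single_mul, mul_rho_single] at h1
    rw [h1]
    congr 1
    ext; simp
  have hCS : (d.factorial : ℂ) • C = ∑ a, ∑ b, C a b • S a b := by
    ext J L
    simp only [Matrix.smul_apply, Matrix.sum_apply, S, Matrix.of_apply, smul_eq_mul,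
      Finset.mul_sum, Finset.prod_ite_zero, Finset.prod_const_one]
    have h1 : ∀ a b, ∑ g : Equiv.Perm (Fin d), (C a b * if ∀ k ∈ Finset.univ,
        a (g k) = J k ∧ b (g k) = L k then (1 : ℂ) else 0) =
        ∑ g : Equiv.Perm (Fin d), if a = J ∘ g.symm ∧ b = L ∘ g.symm then C J L else 0 := by
      intro a b
      refine Finset.sum_congr rfl fun g _ => ?_
      have h2 : (∀ k ∈ Finset.univ, a (g k) = J k ∧ b (g k) = L k) ↔
          a = J ∘ g.symm ∧ b = L ∘ g.symm := by
        constructor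
        · intro h
          exact ⟨funext fun k => by simpa using (h (g.symm k) (Finset.mem_univ _)).1,
            funext fun k => by simpa using (h (g.symm k) (Finset.mem_univ _)).2⟩
        · rintro ⟨rfl, rfl⟩
          simp
      simp only [h2, mul_ite, mul_one, mul_zero]
      split_ifs with h
      · rw [h.1, h.2]
        exact hinv g.symm J L
      · rfl
    simp only [h1]
    have h3 : ∀ a, ∑ b, ∑ g : Equiv.Perm (Fin d),
        (if a = J ∘ g.symm ∧ b = L ∘ g.symm then C J L else 0) =
        ∑ g : Equiv.Perm (Fin d), if a = J ∘ g.symm then C J L else 0 := by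
      intro a
      rw [Finset.sum_comm]
      refine Finset.sum_congr rfl fun g _ => ?_
      simp [ite_and]
    rw [Finset.sum_congr rfl fun a _ => h3 a, Finset.sum_comm]
    simp [Fintype.card_perm]
  have h1 : D * ((d.factorial : ℂ) • C) = ((d.factorial : ℂ) • C) * D := by
    rw [hCS, Finset.mul_sum, Finset.sum_mul]
    refine Finset.sum_congr rfl fun a _ => ?_
    rw [Finset.mul_sum, Finset.sum_mul]
    refine Finset.sum_congr rfl fun b _ => ?_
    rw [mul_smul_comm, hDS, smul_mul_assoc]
  rw [mul_smul_comm, smul_mul_assoc] at h1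
  have hd : (d.factorial : ℂ) ≠ 0 := by exact_mod_cast d.factorial_ne_zero
  exact smul_right_injective _ hd h1

/-! ### From unitary matrices to all matrices -/

theorem infinite_unit_circle : (Metric.sphere (0 : ℂ) 1).Infinite := by
  refine (isPreconnected_sphere (by simp) (0 : ℂ) 1).infinite_of_nontrivial ?_
  exact ⟨1, by simp, -1, by simp, by norm_num⟩

theorem kron_diagonal (x : Fin N → ℂ) :
    kron d (Matrix.diagonal x) = Matrix.diagonal fun J : Fin d → Fin N => ∏ k, x (J k) := by
  ext J L
  by_cases h : J = L
  · subst h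
    simp [kron_apply]
  · rw [Matrix.diagonal_apply_ne _ h, kron_apply]
    obtain ⟨k, hk⟩ := Function.ne_iff.1 h
    exact Finset.prod_eq_zero (Finset.mem_univ k) (Matrix.diagonal_apply_ne _ hk)

/-- Where an entry of `D` is nonzero, commuting with diagonal unitaries makes two monomials agree on
a product of unit circles, hence as polynomials, hence at every `x`. -/
theorem commute_kron_diagonal (D : TMat N d)
    (hD : ∀ u : U N, D * kron d u.1 = kron d u.1 * D) (x : Fin N → ℂ) :
    D * kron d (Matrix.diagonal x) = kron d (Matrix.diagonal x) * D := by
  rw [kron_diagonal]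
  ext J L
  rw [Matrix.mul_diagonal, Matrix.diagonal_mul]
  by_cases h0 : D J L = 0
  · simp [h0]
  have hp : (∏ k, MvPolynomial.X (L k) : MvPolynomial (Fin N) ℂ) = ∏ k, MvPolynomial.X (J k) := by
    refine MvPolynomial.funext_set (fun _ => Metric.sphere (0 : ℂ) 1)
      (fun _ => infinite_unit_circle) fun y hy => ?_
    have hy1 : ∀ i, star (y i) * y i = 1 := fun i => by
      have h1 : ‖y i‖ = 1 := by simpa using hy i (Set.mem_univ i)
      rw [← starRingEnd_apply, mul_comm, Complex.mul_conj, Complex.normSq_eq_norm_sq, h1]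
      simp
    have hu : Matrix.diagonal y ∈ Matrix.unitaryGroup (Fin N) ℂ := by
      rw [Matrix.mem_unitaryGroup_iff', Matrix.star_eq_conjTranspose,
        Matrix.diagonal_conjTranspose, Matrix.diagonal_mul_diagonal, ← Matrix.diagonal_one]
      congr 1
      funext i
      exact hy1 i
    have h1 := congrFun (congrFun (hD ⟨_, hu⟩) J) L
    simp only at h1
    rw [kron_diagonal, Matrix.mul_diagonal, Matrix.diagonal_mul, mul_comm] at h1
    simpa using mul_right_cancel₀ h0 h1
  have h2 := congrArg (MvPolynomial.eval x) hp
  simp only [map_prod, MvPolynomial.eval_X] at h2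
  rw [h2, mul_comm]

open scoped ComplexOrder in
-- Singular value decomposition from the spectral theorem for X*X; invertibility allows division by
-- the singular values.
theorem exists_unitary_diagonal_unitary {X : Matrix (Fin N) (Fin N) ℂ} (hX : IsUnit X) :
    ∃ (u v : U N) (x : Fin N → ℂ), X = u.1 * Matrix.diagonal x * v.1 := by
  have hpd : (X.conjTranspose * X).PosDef :=
    Matrix.PosDef.conjTranspose_mul_self X (Matrix.mulVec_injective_of_isUnit hX)
  have hH := hpd.isHermitian
  let w : U N := hH.eigenvectorUnitary
  let ev := hH.eigenvalues
  have hpos : ∀ i, 0 < ev i := hpd.eigenvalues_pos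
  let s : Fin N → ℂ := fun i => (Real.sqrt (ev i) : ℂ)
  have hs0 : ∀ i, s i ≠ 0 := fun i => by
    simp only [s, ne_eq, Complex.ofReal_eq_zero]
    exact (Real.sqrt_pos.2 (hpos i)).ne'
  have hww : star w.1 * w.1 = 1 := Matrix.mem_unitaryGroup_iff'.1 w.2
  have hww' : w.1 * star w.1 = 1 := Matrix.mem_unitaryGroup_iff.1 w.2
  have hspec : X.conjTranspose * X =
      w.1 * Matrix.diagonal (fun i => (ev i : ℂ)) * star w.1 := hH.spectral_theorem
  let u : Matrix (Fin N) (Fin N) ℂ := X * w.1 * Matrix.diagonal fun i => (s i)⁻¹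
  have hu : u ∈ Matrix.unitaryGroup (Fin N) ℂ := by
    rw [Matrix.mem_unitaryGroup_iff']
    have h1 : star u = Matrix.diagonal (fun i => (s i)⁻¹) * star w.1 * X.conjTranspose := by
      simp only [u, Matrix.star_eq_conjTranspose, Matrix.conjTranspose_mul,
        Matrix.diagonal_conjTranspose, mul_assoc]
      congr 2
      funext i
      simp [s]
    calc star u * u = Matrix.diagonal (fun i => (s i)⁻¹) * star w.1 *
          (X.conjTranspose * X) * w.1 * Matrix.diagonal fun i => (s i)⁻¹ := by
          rw [h1]; simp only [u, mul_assoc]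
      _ = Matrix.diagonal (fun i => (s i)⁻¹) * (star w.1 * w.1) *
          Matrix.diagonal (fun i => (ev i : ℂ)) * (star w.1 * w.1) *
          Matrix.diagonal fun i => (s i)⁻¹ := by
          rw [hspec]; simp only [mul_assoc]
      _ = 1 := by
          rw [hww, mul_one, mul_one, Matrix.diagonal_mul_diagonal, Matrix.diagonal_mul_diagonal,
            ← Matrix.diagonal_one]
          congr 1
          funext i
          have h2 : s i * s i = ev i := by
            simp only [s]
            rw [← Complex.ofReal_mul, Real.mul_self_sqrt (hpos i).le]
          rw [← h2]
          field_simp [hs0 i]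
  refine ⟨⟨u, hu⟩, w⁻¹, s, ?_⟩
  have h3 : (Matrix.diagonal fun i => (s i)⁻¹) * Matrix.diagonal s = 1 := by
    rw [Matrix.diagonal_mul_diagonal, ← Matrix.diagonal_one]
    congr 1
    funext i
    exact inv_mul_cancel₀ (hs0 i)
  change X = X * w.1 * (Matrix.diagonal fun i => (s i)⁻¹) * Matrix.diagonal s * star w.1
  rw [mul_assoc (X * w.1), h3, mul_one, mul_assoc, hww', mul_one]

theorem continuous_kron : Continuous (kron d : Matrix (Fin N) (Fin N) ℂ → TMat N d) := by
  refine continuous_matrix fun J L => ?_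
  simp only [kron_apply]
  exact continuous_finsetProd _ fun k _ => continuous_id.matrix_elem _ _

/-- Invertible matrices follow from the singular value decomposition, and a general `X` by density
of invertible matrices on the line t - X. -/
theorem commute_kron_of_unitary (D : TMat N d)
    (hD : ∀ u : U N, D * kron d u.1 = kron d u.1 * D) (X : Matrix (Fin N) (Fin N) ℂ) :
    D * kron d X = kron d X * D := by
  have hunit : ∀ Y : Matrix (Fin N) (Fin N) ℂ, IsUnit Y → D * kron d Y = kron d Y * D := by
    intro Y hY
    obtain ⟨u, v, x, rfl⟩ := exists_unitary_diagonal_unitary hY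
    rw [kron_mul, kron_mul, ← mul_assoc, ← mul_assoc, hD, mul_assoc (kron d u.1),
      commute_kron_diagonal D hD, ← mul_assoc, mul_assoc, hD, mul_assoc, mul_assoc, mul_assoc]
  have hline : Continuous fun t : ℂ => Matrix.scalar (Fin N) t - X := by
    refine Continuous.sub ?_ continuous_const
    exact Continuous.matrix_diagonal (continuous_pi fun _ => continuous_id)
  have hfin : {t : ℂ | X.charpoly.IsRoot t}.Finite :=
    Polynomial.finite_setOfPred_isRoot (Matrix.charpoly_monic X).ne_zero
  have hdense : Dense {t : ℂ | X.charpoly.IsRoot t}ᶜ := hfin.countable.dense_compl ℂ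
  have h1 : (fun t : ℂ => D * kron d (Matrix.scalar (Fin N) t - X)) =
      fun t => kron d (Matrix.scalar (Fin N) t - X) * D := by
    refine Continuous.ext_on hdense ?_ ?_ ?_
    · exact continuous_const.matrix_mul (continuous_kron.comp hline)
    · exact (continuous_kron.comp hline).matrix_mul continuous_const
    · intro t ht
      refine hunit _ ((Matrix.isUnit_iff_isUnit_det _).2 ?_)
      rw [← Matrix.eval_charpoly]
      exact isUnit_iff_ne_zero.2 ht
  -- At t = 0 the line passes through -X; its tensor power differs from that of X by the invertible
  -- factor (-1)^d.
  have h2 := congrFun h1 0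
  have h3 : kron d (-X) = (-1 : ℂ) ^ d • kron d X := by
    ext J L
    simp [kron_apply, Finset.prod_neg]
  simp only [map_zero, zero_sub, h3, mul_smul_comm, smul_mul_assoc] at h2
  exact smul_right_injective _ (pow_ne_zero d (by norm_num : (-1 : ℂ) ≠ 0)) h2

/-- The commutant of the tensor powers of unitary matrices is spanned by permutations. -/
theorem exists_rho_eq_of_commute_unitary (D : TMat N d)
    (hD : ∀ u : U N, D * kron d u.1 = kron d u.1 * D) : ∃ x, rho N d x = D :=
  exists_rho_eq D (commute_of_commute_kron D (commute_kron_of_unitary D hD))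

end CharExp

end

noncomputable section

namespace CharExp

open MeasureTheory

variable {N d : ℕ}

/-! ### Haar measure -/

instance instIsHaarMeasureHaarU (N : ℕ) : (haarU N).IsHaarMeasure := by
  unfold haarU
  infer_instance

instance instIsProbabilityMeasureHaarU (N : ℕ) : IsProbabilityMeasure (haarU N) := by
  constructor
  have h := Measure.haarMeasure_self (K₀ := (⊤ : TopologicalSpace.PositiveCompacts (U N)))
  rwa [TopologicalSpace.PositiveCompacts.coe_top] at h

theorem integrable_of_continuous {f : U N → ℂ} (hf : Continuous f) : Integrable f (haarU N) :=
  hf.integrable_of_hasCompactSupport (HasCompactSupport.of_compactSpace f)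

/-- The entrywise integral of a matrix-valued function. -/
def matInt (F : U N → TMat N d) : TMat N d := Matrix.of fun J L => ∫ u, F u J L ∂(haarU N)

theorem mul_matInt (P : TMat N d) {F : U N → TMat N d} (hF : Continuous F) :
    P * matInt F = matInt fun u => P * F u := by
  ext J L
  simp only [matInt, Matrix.mul_apply, Matrix.of_apply]
  have h : ∀ A, Integrable (fun u => P J A * F u A L) (haarU N) := fun A =>
    integrable_of_continuous (continuous_const.mul (hF.matrix_elem A L))
  rw [integral_finsetSum _ fun A _ => h A]
  exact Finset.sum_congr rfl fun A _ => (integral_const_mul _ _).symm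

theorem matInt_mul (P : TMat N d) {F : U N → TMat N d} (hF : Continuous F) :
    matInt F * P = matInt fun u => F u * P := by
  ext J L
  simp only [matInt, Matrix.mul_apply, Matrix.of_apply]
  have h : ∀ A, Integrable (fun u => F u J A * P A L) (haarU N) := fun A =>
    integrable_of_continuous ((hF.matrix_elem J A).mul continuous_const)
  rw [integral_finsetSum _ fun A _ => h A]
  exact Finset.sum_congr rfl fun A _ => (integral_mul_const _ _).symm

theorem trace_matInt {F : U N → TMat N d} (hF : Continuous F) :
    (matInt F).trace = ∫ u, (F u).trace ∂(haarU N) := by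
  simp only [matInt, Matrix.trace, Matrix.diag_apply, Matrix.of_apply]
  rw [integral_finsetSum _ fun A _ => integrable_of_continuous (hF.matrix_elem A A)]

theorem matInt_mul_left (F : U N → TMat N d) (v : U N) : (matInt fun u => F (v * u)) = matInt F := by
  ext J L
  simp only [matInt, Matrix.of_apply]
  exact integral_mul_left_eq_self (fun u => F u J L) v

/-- The tensor power of a unitary matrix. -/
def ukron (d : ℕ) (u : U N) : TMat N d := kron d u.1

theorem ukron_mul (u v : U N) : ukron d (u * v) = ukron d u * ukron d v := kron_mul u.1 v.1

theorem ukron_one : ukron d (1 : U N) = 1 := kron_one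

theorem ukron_inv_mul (u : U N) : ukron d u⁻¹ * ukron d u = 1 := by
  rw [← ukron_mul, inv_mul_cancel, ukron_one]

theorem continuous_ukron : Continuous (ukron d : U N → TMat N d) :=
  continuous_kron.comp continuous_subtype_val

theorem continuous_conj (M : TMat N d) :
    Continuous fun u : U N => ukron d u * M * ukron d u⁻¹ :=
  (continuous_ukron.matrix_mul continuous_const).matrix_mul
    (continuous_ukron.comp continuous_inv)

/-- The average of a matrix over conjugation by tensor powers of unitary matrices. -/
def avg (M : TMat N d) : TMat N d := matInt fun u => ukron d u * M * ukron d u⁻¹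

theorem avg_commute (M : TMat N d) (v : U N) : avg M * ukron d v = ukron d v * avg M := by
  rw [avg, matInt_mul _ (continuous_conj M), mul_matInt _ (continuous_conj M),
    ← matInt_mul_left _ v]
  congr 1
  funext u
  rw [mul_inv_rev, ukron_mul, ukron_mul]
  simp only [mul_assoc]
  rw [ukron_inv_mul, mul_one]

theorem trace_mul_avg (P M : TMat N d) : (P * avg M).trace =
    ∫ u, (P * (ukron d u * M * ukron d u⁻¹)).trace ∂(haarU N) := by
  rw [avg, mul_matInt _ (continuous_conj M)]
  exact trace_matInt (continuous_const.matrix_mul (continuous_conj M))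

theorem exists_rho_eq_avg (M : TMat N d) : ∃ x, rho N d x = avg M :=
  exists_rho_eq_of_commute_unitary _ (avg_commute M)

/-! ### The average in terms of permutations -/

/-- The element `∑ g, tr (M g⁻¹) g` of the group algebra. -/
def permTrace (M : TMat N d) : GA d := ∑ g : Equiv.Perm (Fin d),
  (M * rho N d (MonoidAlgebra.single g⁻¹ 1)).trace • MonoidAlgebra.single g (1 : ℂ)

theorem permTrace_coeff (M : TMat N d) (g : Equiv.Perm (Fin d)) :
    (permTrace M).coeff g = (M * rho N d (MonoidAlgebra.single g⁻¹ 1)).trace := by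
  rw [permTrace, MonoidAlgebra.coeff_sum, Finsupp.finsetSum_apply]
  simp [Finsupp.single_apply]

theorem permTrace_add (M M' : TMat N d) : permTrace (M + M') = permTrace M + permTrace M' := by
  simp only [permTrace, add_mul, Matrix.trace_add, add_smul, Finset.sum_add_distrib]

theorem permTrace_smul (r : ℂ) (M : TMat N d) : permTrace (r • M) = r • permTrace M := by
  simp only [permTrace, smul_mul_assoc, Matrix.trace_smul, smul_assoc, Finset.smul_sum]

/-- Linearity over the group algebra reduces the recovery of `x` on tensors to inverting the single
element `permTrace 1`. -/
theorem permTrace_rho (x : GA d) : permTrace (rho N d x) = x * permTrace (1 : TMat N d) := by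
  induction x using MonoidAlgebra.induction_on with
  | of h =>
    rw [MonoidAlgebra.of_apply]
    refine MonoidAlgebra.coeff_injective (Finsupp.ext fun g => ?_)
    rw [MonoidAlgebra.coeff_single_mul_apply, permTrace_coeff, permTrace_coeff, ← map_mul,
      MonoidAlgebra.single_mul_single, Matrix.one_mul, mul_inv_rev, inv_inv, one_mul, one_mul]
    rw [← one_mul (1 : ℂ), ← MonoidAlgebra.single_mul_single, ← MonoidAlgebra.single_mul_single,
      map_mul, map_mul, Matrix.trace_mul_comm]
  | add a b ha hb => rw [map_add, permTrace_add, add_mul, ha, hb]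
  | smul r a ha => rw [map_smul, permTrace_smul, smul_mul_assoc, ha]

/-- Permutations commute with U^{⊗d}, so traces against them do not see the conjugation. -/
theorem permTrace_avg (M : TMat N d) : permTrace (avg M) = permTrace M := by
  refine MonoidAlgebra.coeff_injective (Finsupp.ext fun g => ?_)
  rw [permTrace_coeff, permTrace_coeff, Matrix.trace_mul_comm, trace_mul_avg]
  have h : ∀ u : U N, (rho N d (MonoidAlgebra.single g⁻¹ 1) *
      (ukron d u * M * ukron d u⁻¹)).trace = (M * rho N d (MonoidAlgebra.single g⁻¹ 1)).trace := by
    intro u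
    rw [← mul_assoc, ← mul_assoc, Matrix.trace_mul_comm, ← mul_assoc, ← mul_assoc, ukron,
      ← rho_mul_kron, mul_assoc (rho N d _)]
    change (rho N d (MonoidAlgebra.single g⁻¹ 1) * (ukron d u⁻¹ * ukron d u) * M).trace = _
    rw [ukron_inv_mul, mul_one, Matrix.trace_mul_comm]
  simp only [h, integral_const, probReal_univ, one_smul]

/-- The element is central because permutations commute with X^{⊗d}. Its coordinate at a shape is
found by multiplying by the primitive idempotent and comparing coefficients at 1. -/
theorem permTrace_kron (X : Matrix (Fin N) (Fin N) ℂ) :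
    permTrace (kron d X) =
      ∑ l : Shape d, (kap l * (rho N d (idem l) * kron d X).trace) • cent l := by
  have hc : permTrace (kron d X) ∈ center d := by
    intro y
    induction y using MonoidAlgebra.induction_on with
    | of h =>
      rw [MonoidAlgebra.of_apply]
      refine MonoidAlgebra.coeff_injective (Finsupp.ext fun g => ?_)
      rw [MonoidAlgebra.coeff_single_mul_apply, MonoidAlgebra.coeff_mul_single_apply,
        permTrace_coeff, permTrace_coeff, one_mul, mul_one, mul_inv_rev, inv_inv, mul_inv_rev,
        inv_inv, ← one_mul (1 : ℂ), ← MonoidAlgebra.single_mul_single,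
        ← MonoidAlgebra.single_mul_single, map_mul, map_mul, ← mul_assoc, Matrix.trace_mul_comm,
        ← mul_assoc, rho_mul_kron, mul_assoc]
    | add a b ha hb => rw [add_mul, mul_add, ha, hb]
    | smul r a ha => rw [smul_mul_assoc, mul_smul_comm, ha]
  obtain ⟨a, ha⟩ := exists_eq_sum_cent hc
  rw [ha]
  refine Finset.sum_congr rfl fun l _ => ?_
  congr 1
  have h1 : permTrace (kron d X) * idem l = a l • idem l := by
    rw [ha, ← cent_mul_idem l, ← mul_assoc, sum_smul_cent_mul_cent, smul_mul_assoc]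
  have h2 : (permTrace (kron d X) * idem l).coeff 1 = (rho N d (idem l) * kron d X).trace := by
    rw [permTrace, Finset.sum_mul, MonoidAlgebra.coeff_sum, Finsupp.finsetSum_apply]
    conv_rhs => rw [groupAlgebra_eq_sum (idem l), map_sum, Finset.sum_mul, Matrix.trace_sum]
    refine Fintype.sum_equiv (Equiv.inv _) _ _ fun g => ?_
    rw [smul_mul_assoc, MonoidAlgebra.coeff_smul_apply, MonoidAlgebra.coeff_single_mul_apply,
      map_smul, smul_mul_assoc, Matrix.trace_smul, Equiv.inv_apply, one_mul, mul_one, smul_eq_mul,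
      smul_eq_mul, Matrix.trace_mul_comm, mul_comm]
  rw [h1, MonoidAlgebra.coeff_smul_apply, idem_coeff_one, smul_eq_mul] at h2
  rw [← h2]
  field_simp [kap_ne_zero l]

/-- The element inverting `∑ g, tr (g⁻¹) g` on the tensor power. -/
def wein (N d : ℕ) : GA d := ∑ l : Shape d, (kap l * dimW N l.1)⁻¹ • cent l

theorem sum_smul_cent_mul_wein (a : Shape d → ℂ) :
    (∑ l, a l • cent l) * wein N d = ∑ l, (a l * (kap l * dimW N l.1)⁻¹) • cent l := by
  rw [wein, Finset.mul_sum]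
  refine Finset.sum_congr rfl fun l _ => ?_
  rw [mul_smul_comm, sum_smul_cent_mul_cent, smul_smul, mul_comm]

theorem rho_permTrace_one_mul_wein : rho N d (permTrace (1 : TMat N d) * wein N d) = 1 := by
  have h1 : (1 : TMat N d) = ∑ l : Shape d, rho N d (cent l) := by
    rw [← map_sum, sum_cent, map_one]
  rw [← kron_one, permTrace_kron, sum_smul_cent_mul_wein, map_sum, kron_one]
  refine Eq.trans ?_ h1.symm
  refine Finset.sum_congr rfl fun l _ => ?_
  rw [mul_one, trace_rho_idem, map_smul]
  -- Here the coefficient in `wein` is the inverse of zero, taken as zero; this is harmless because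
  -- the central idempotent also acts as zero.
  by_cases h : dimW N l.1 = 0
  · rw [rho_cent_eq_zero h, smul_zero]
  · have h' : (dimW N l.1 : ℂ) ≠ 0 := by exact_mod_cast h
    rw [mul_inv_cancel₀ (mul_ne_zero (kap_ne_zero l) h'), one_smul]

theorem avg_eq (M : TMat N d) : avg M = rho N d (permTrace M * wein N d) := by
  obtain ⟨x, hx⟩ := exists_rho_eq_avg M
  rw [← permTrace_avg, ← hx, permTrace_rho, mul_assoc, map_mul, rho_permTrace_one_mul_wein, mul_one]

/-! ### Moments -/

theorem trace_rho_idem_mul_kron (l : Shape d) {B : Matrix (Fin N) (Fin N) ℂ} {b : Fin N → ℂ}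
    (hb : AreEigenvalues B b) :
    (rho N d (idem l) * kron d B).trace = MvPolynomial.eval b (schur N l.1) := by
  have hd : (d.factorial : ℂ) ≠ 0 := by exact_mod_cast d.factorial_ne_zero
  rw [eval_schur l hb, trace_rho_classSum_mul_kron, inv_mul_cancel_left₀ hd]

/-- The integral is tr(A^{⊗d} `avg`(B^{⊗d})). In `avg_eq` the factors κ of `permTrace` and `wein`
cancel, leaving 1/dim W and one dim V from the central idempotent. -/
theorem integral_trace_conj_pow {A B : Matrix (Fin N) (Fin N) ℂ} {a b : Fin N → ℂ}
    (ha : AreEigenvalues A a) (hb : AreEigenvalues B b) (d : ℕ) :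
    ∫ u : U N, (A * (u : Matrix (Fin N) (Fin N) ℂ) * B *
      ((u⁻¹ : U N) : Matrix (Fin N) (Fin N) ℂ)).trace ^ d ∂(haarU N) =
    ∑ l : Shape d, MvPolynomial.eval a (schur N l.1) * MvPolynomial.eval b (schur N l.1) *
      ((dimV l.1 : ℂ) / (dimW N l.1 : ℂ)) := by
  have h1 : ∀ u : U N, (A * (u : Matrix (Fin N) (Fin N) ℂ) * B *
      ((u⁻¹ : U N) : Matrix (Fin N) (Fin N) ℂ)).trace ^ d =
      (kron d A * (ukron d u * kron d B * ukron d u⁻¹)).trace := fun u => by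
    rw [← trace_kron, kron_mul, kron_mul, kron_mul]
    simp only [mul_assoc, ukron]
  simp only [h1]
  rw [← trace_mul_avg, avg_eq, permTrace_kron, sum_smul_cent_mul_wein, map_sum, Finset.mul_sum,
    Matrix.trace_sum]
  refine Finset.sum_congr rfl fun l _ => ?_
  rw [map_smul, mul_smul_comm, ← rho_mul_kron, Matrix.trace_smul, trace_rho_cent_mul_kron l ha,
    trace_rho_idem_mul_kron l hb, mul_inv, smul_eq_mul]
  field_simp [kap_ne_zero l]

/-- Writes a product of two traces linearly in X E Y, so that the average of a matrix unit E can be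
inserted. -/
theorem sum_mul_single_mul_apply (X Y : TMat N d) :
    ∑ J, ∑ K, (X * (Matrix.single J K 1 : TMat N d) * Y) J K = X.trace * Y.trace := by
  rw [Matrix.trace, Matrix.trace, Finset.sum_mul_sum]
  refine Finset.sum_congr rfl fun J _ => Finset.sum_congr rfl fun K _ => ?_
  rw [Matrix.mul_apply, Finset.sum_eq_single K]
  · simp
  · intro L _ hL
    rw [Matrix.mul_single_apply_of_ne _ _ _ _ _ hL, zero_mul]
  · simp

theorem integral_trace_pow_mul_trace_pow {A B : Matrix (Fin N) (Fin N) ℂ} {c : Fin N → ℂ}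
    (hc : AreEigenvalues (A * B) c) (d : ℕ) :
    ∫ u : U N, (A * (u : Matrix (Fin N) (Fin N) ℂ)).trace ^ d *
      (B * ((u⁻¹ : U N) : Matrix (Fin N) (Fin N) ℂ)).trace ^ d ∂(haarU N) =
    ∑ l : Shape d, MvPolynomial.eval c (schur N l.1) *
      ((dimV l.1 : ℂ) ^ 2 / (dimW N l.1 : ℂ)) := by
  have h1 : ∀ u : U N, (A * (u : Matrix (Fin N) (Fin N) ℂ)).trace ^ d *
      (B * ((u⁻¹ : U N) : Matrix (Fin N) (Fin N) ℂ)).trace ^ d =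
      ∑ J, ∑ K, (kron d A * (ukron d u * (Matrix.single J K 1 : TMat N d) * ukron d u⁻¹) * kron d B) J K := by
    intro u
    rw [Matrix.trace_mul_comm B, ← trace_kron, ← trace_kron, kron_mul, kron_mul,
      ← sum_mul_single_mul_apply]
    simp only [mul_assoc, ukron]
  have hcont : ∀ J K, Continuous fun u : U N =>
      kron d A * (ukron d u * (Matrix.single J K 1 : TMat N d) * ukron d u⁻¹) * kron d B := fun J K =>
    (continuous_const.matrix_mul (continuous_conj _)).matrix_mul continuous_const
  have h2 : ∀ J K, ∫ u : U N,
      (kron d A * (ukron d u * (Matrix.single J K 1 : TMat N d) * ukron d u⁻¹) * kron d B) J K ∂(haarU N) =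
      (kron d A * avg (Matrix.single J K 1 : TMat N d) * kron d B) J K := fun J K => by
    rw [avg, mul_matInt _ (continuous_conj _),
      matInt_mul _ (continuous_const.matrix_mul (continuous_conj _))]
    rfl
  have h3 : ∀ J K, (kron d A * avg (Matrix.single J K 1 : TMat N d) * kron d B) J K =
      ∑ g : Equiv.Perm (Fin d), rho N d (MonoidAlgebra.single g⁻¹ 1) K J *
        (kron d A * (rho N d (MonoidAlgebra.single g 1) * rho N d (wein N d)) * kron d B) J K := by
    intro J K
    rw [avg_eq, permTrace, Finset.sum_mul, map_sum, Finset.mul_sum, Finset.sum_mul,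
      Matrix.sum_apply]
    refine Finset.sum_congr rfl fun g _ => ?_
    rw [smul_mul_assoc, map_smul, mul_smul_comm, smul_mul_assoc, Matrix.smul_apply, smul_eq_mul,
      map_mul, Matrix.trace_single_mul, one_smul]
  -- Summation over the matrix units rebuilds a trace in which g⁻¹ meets g and cancels, so the value
  -- does not depend on `g`.
  have h4 : ∀ g : Equiv.Perm (Fin d), ∑ J, ∑ K, rho N d (MonoidAlgebra.single g⁻¹ 1) K J *
      (kron d A * (rho N d (MonoidAlgebra.single g 1) * rho N d (wein N d)) * kron d B) J K =
      (rho N d (wein N d) * kron d (A * B)).trace := by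
    intro g
    rw [Finset.sum_comm]
    change (rho N d (MonoidAlgebra.single g⁻¹ 1) * (kron d A *
      (rho N d (MonoidAlgebra.single g 1) * rho N d (wein N d)) * kron d B)).trace = _
    have h5 : rho N d (MonoidAlgebra.single g⁻¹ 1) * rho N d (MonoidAlgebra.single g 1) = 1 := by
      rw [← map_mul, MonoidAlgebra.single_mul_single, inv_mul_cancel, mul_one,
        ← MonoidAlgebra.one_def, map_one]
    rw [← mul_assoc, ← mul_assoc, rho_mul_kron, mul_assoc (kron d A), ← mul_assoc (rho N d _), h5,
      one_mul, ← rho_mul_kron, mul_assoc, ← kron_mul]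
  simp only [h1]
  rw [integral_finsetSum _ fun J _ => integrable_of_continuous
    (continuous_finsetSum _ fun K _ => (hcont J K).matrix_elem J K)]
  have h5 : ∀ J, ∫ u : U N, ∑ K, (kron d A * (ukron d u * (Matrix.single J K 1 : TMat N d) * ukron d u⁻¹) *
      kron d B) J K ∂(haarU N) = ∑ K, (kron d A * avg (Matrix.single J K 1 : TMat N d) * kron d B) J K := by
    intro J
    rw [integral_finsetSum _ fun K _ => integrable_of_continuous ((hcont J K).matrix_elem J K)]
    exact Finset.sum_congr rfl fun K _ => h2 J K
  simp only [h5, h3]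
  have h6 : ∀ F : (Fin d → Fin N) → (Fin d → Fin N) → Equiv.Perm (Fin d) → ℂ,
      ∑ J, ∑ K, ∑ g, F J K g = ∑ g, ∑ J, ∑ K, F J K g := fun F => by
    rw [Finset.sum_comm]
    refine Eq.trans (Finset.sum_congr rfl fun J _ => Finset.sum_comm) ?_
    rw [Finset.sum_comm]
    exact Finset.sum_congr rfl fun g _ => Finset.sum_comm
  rw [h6]
  simp only [h4]
  -- The d! equal contributions combine with 1/κ from `wein` into a second factor dim V.
  rw [Finset.sum_const, Finset.card_univ, Fintype.card_perm, Fintype.card_fin, nsmul_eq_mul, wein,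
    map_sum, Finset.sum_mul, Matrix.trace_sum, Finset.mul_sum]
  refine Finset.sum_congr rfl fun l _ => ?_
  rw [map_smul, smul_mul_assoc, Matrix.trace_smul, trace_rho_cent_mul_kron l hc, dimV_eq, mul_inv,
    smul_eq_mul]
  ring

end CharExp

end

noncomputable section

namespace CharExp

open MeasureTheory

variable {N d : ℕ}

/-! ### Sums over diagrams -/

theorem mem_diagrams {lam : YoungDiagram} :
    lam ∈ diagrams N d ↔ lam.card = d ∧ numRows lam ≤ N := by
  simp [diagrams]

/-- Diagrams with more than `N` rows have `dimW` zero, so the row restriction may be dropped. -/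
theorem sum_diagrams_eq_sum_shape {α : Type*} [AddCommMonoid α] (F : YoungDiagram → α)
    (hF : ∀ l : Shape d, dimW N l.1 = 0 → F l.1 = 0) :
    ∑ lam ∈ diagrams N d, F lam = ∑ l : Shape d, F l.1 := by
  refine Finset.sum_bij_ne_zero (fun lam h _ => ⟨lam, (mem_diagrams.1 h).1⟩) ?_ ?_ ?_ ?_
  · intros
    exact Finset.mem_univ _
  · intro lam _ _ mu _ _ h
    exact congrArg Subtype.val h
  · intro l _ hl
    refine ⟨l.1, mem_diagrams.2 ⟨l.2, ?_⟩, hl, rfl⟩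
    by_contra h
    exact hl (hF l (dimW_eq_zero (not_le.1 h)))
  · intros
    rfl

theorem hcizTerm_eq_sum (d : ℕ) (p : ℂ × (Fin N → ℂ) × (Fin N → ℂ)) :
    hcizTerm N d p = ∑ lam ∈ diagrams N d, hcizDiagramTerm N lam p := by
  rw [hcizTerm, Finset.mul_sum]
  refine Finset.sum_congr rfl fun lam h => ?_
  rw [hcizDiagramTerm, (mem_diagrams.1 h).1]

theorem bgwTerm_eq_sum (d : ℕ) (p : ℂ × (Fin N → ℂ)) :
    bgwTerm N d p = ∑ lam ∈ diagrams N d, bgwDiagramTerm N lam p := by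
  rw [bgwTerm, Finset.mul_sum]
  refine Finset.sum_congr rfl fun lam h => ?_
  rw [bgwDiagramTerm, (mem_diagrams.1 h).1]

theorem hcizDiagramTerm_eq_zero {lam : YoungDiagram} (h : dimW N lam = 0)
    (p : ℂ × (Fin N → ℂ) × (Fin N → ℂ)) : hcizDiagramTerm N lam p = 0 := by
  simp [hcizDiagramTerm, h]

theorem bgwDiagramTerm_eq_zero {lam : YoungDiagram} (h : dimW N lam = 0)
    (p : ℂ × (Fin N → ℂ)) : bgwDiagramTerm N lam p = 0 := by
  simp [bgwDiagramTerm, h]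

/-! ### Bounds -/

theorem dimV_le {l : Shape d} (h : dimW N l.1 ≠ 0) : dimV l.1 ≤ N ^ d := by
  rw [← sum_dimV_mul_dimW N d]
  refine le_trans ?_ (Finset.single_le_sum (f := fun l : Shape d => dimV l.1 * dimW N l.1)
    (fun _ _ => Nat.zero_le _) (Finset.mem_univ l))
  exact Nat.le_mul_of_pos_right _ (Nat.pos_of_ne_zero h)

theorem card_shape_dimW_ne_zero_le (N d : ℕ) :
    (Finset.univ.filter fun l : Shape d => dimW N l.1 ≠ 0).card ≤ N ^ d := by
  rw [← sum_dimV_mul_dimW N d, Finset.card_filter]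
  refine Finset.sum_le_sum fun l _ => ?_
  split_ifs with h
  · exact Nat.mul_pos (dimV_pos l) (Nat.pos_of_ne_zero h)
  · exact Nat.zero_le _

theorem norm_eval_psumPart_le (g : Equiv.Perm (Fin d)) {a : Fin N → ℂ} {R : ℝ}
    (ha : ∀ i, ‖a i‖ ≤ R) :
    ‖MvPolynomial.eval a (MvPolynomial.psumPart (Fin N) ℂ g.partition)‖ ≤ N ^ d * R ^ d := by
  rw [← sum_invariant_eq_psumPart]
  have h1 : ∀ J : Fin d → Fin N, ‖∏ k, a (J k)‖ ≤ R ^ d := fun J => by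
    rw [norm_prod]
    refine (Finset.prod_le_prod (fun _ _ => norm_nonneg _) fun k _ => ha (J k)).trans ?_
    simp
  calc _ ≤ ∑ J : Fin d → Fin N with ∀ k, J (g k) = J k, ‖∏ k, a (J k)‖ := norm_sum_le _ _
    _ ≤ ∑ J : Fin d → Fin N, ‖∏ k, a (J k)‖ :=
      Finset.sum_le_sum_of_subset_of_nonneg (Finset.filter_subset _ _) fun _ _ _ => norm_nonneg _
    _ ≤ ∑ _J : Fin d → Fin N, R ^ d := Finset.sum_le_sum fun J _ => h1 J
    _ = N ^ d * R ^ d := by simp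

theorem norm_eval_schur_le (l : Shape d) {a : Fin N → ℂ} {R : ℝ} (ha : ∀ i, ‖a i‖ ≤ R) :
    ‖MvPolynomial.eval a (schur N l.1)‖ ≤ dimV l.1 * (N ^ d * R ^ d) := by
  obtain ⟨lam, rfl⟩ := l
  have hd : (0 : ℝ) < lam.card.factorial := by exact_mod_cast lam.card.factorial_pos
  rw [schur, map_mul, MvPolynomial.eval_C, map_sum, norm_mul, norm_inv, RCLike.norm_natCast,
    inv_mul_le_iff₀ hd]
  refine (norm_sum_le _ _).trans ?_
  have h1 : ∀ g ∈ (Finset.univ : Finset (Equiv.Perm (Fin lam.card))),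
      ‖MvPolynomial.eval a (MvPolynomial.C ((Vrep lam).character g) *
        MvPolynomial.psumPart (Fin N) ℂ g.partition)‖ ≤
      dimV lam * (N ^ lam.card * R ^ lam.card) := fun g _ => by
    rw [map_mul, MvPolynomial.eval_C, norm_mul, character_Vrep]
    exact mul_le_mul (norm_chi_le _ g) (norm_eval_psumPart_le g ha) (norm_nonneg _)
      (Nat.cast_nonneg _)
  refine (Finset.sum_le_card_nsmul _ _ _ h1).trans ?_
  simp [Fintype.card_perm]

/-- A common majorant of the terms indexed by diagrams. -/
def majorant (N : ℕ) (R : ℝ) (lam : YoungDiagram) : ℝ :=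
  if dimW N lam = 0 then 0 else (R ^ 3 * N ^ 6) ^ lam.card / lam.card.factorial

theorem norm_div_dimW_le (x : ℂ) {lam : YoungDiagram} (h : dimW N lam ≠ 0) :
    ‖x / (dimW N lam : ℂ)‖ ≤ ‖x‖ := by
  rw [norm_div, RCLike.norm_natCast]
  exact div_le_self (norm_nonneg _) (by exact_mod_cast Nat.pos_of_ne_zero h)

theorem norm_hcizDiagramTerm_le {R : ℝ} (lam : YoungDiagram)
    {p : ℂ × (Fin N → ℂ) × (Fin N → ℂ)} (hp : ‖p‖ ≤ R) :
    ‖hcizDiagramTerm N lam p‖ ≤ majorant N R lam := by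
  rw [majorant]
  split_ifs with h
  · rw [hcizDiagramTerm_eq_zero h, norm_zero]
  have hR : 0 ≤ R := (norm_nonneg p).trans hp
  have hz : ‖p.1‖ ≤ R := (norm_fst_le p).trans hp
  have ha : ∀ i, ‖p.2.1 i‖ ≤ R := fun i =>
    (norm_le_pi_norm _ i).trans ((norm_fst_le p.2).trans ((norm_snd_le p).trans hp))
  have hb : ∀ i, ‖p.2.2 i‖ ≤ R := fun i =>
    (norm_le_pi_norm _ i).trans ((norm_snd_le p.2).trans ((norm_snd_le p).trans hp))
  let l : Shape lam.card := ⟨lam, rfl⟩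
  have hf : (dimV lam : ℝ) ≤ N ^ lam.card := by exact_mod_cast dimV_le (l := l) h
  have hs : ∀ {a : Fin N → ℂ}, (∀ i, ‖a i‖ ≤ R) →
      ‖MvPolynomial.eval a (schur N lam)‖ ≤ N ^ lam.card * (N ^ lam.card * R ^ lam.card) :=
    fun ha => (norm_eval_schur_le l ha).trans (by gcongr)
  rw [hcizDiagramTerm]
  simp only [norm_mul]
  rw [norm_div, norm_pow, norm_pow, RCLike.norm_natCast, RCLike.norm_natCast]
  -- R enters once through z and once through each Schur value. N enters once explicitly, twice per
  -- Schur value and once through dim V, giving R³N⁶.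
  calc _ ≤ R ^ lam.card / lam.card.factorial * N ^ lam.card *
        (N ^ lam.card * (N ^ lam.card * R ^ lam.card) *
          (N ^ lam.card * (N ^ lam.card * R ^ lam.card)) * N ^ lam.card) := by
        gcongr
        · exact hs ha
        · exact hs hb
        · refine (norm_div_dimW_le _ h).trans ?_
          rwa [RCLike.norm_natCast]
    _ = _ := by rw [mul_pow, ← pow_mul, ← pow_mul]; ring

theorem norm_bgwDiagramTerm_le {R : ℝ} (lam : YoungDiagram)
    {p : ℂ × (Fin N → ℂ)} (hp : ‖p‖ ≤ R) :
    ‖bgwDiagramTerm N lam p‖ ≤ majorant N R lam := by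
  rw [majorant]
  split_ifs with h
  · rw [bgwDiagramTerm_eq_zero h, norm_zero]
  have hR : 0 ≤ R := (norm_nonneg p).trans hp
  have hz : ‖p.1‖ ≤ R := (norm_fst_le p).trans hp
  have hc : ∀ i, ‖p.2 i‖ ≤ R := fun i => (norm_le_pi_norm _ i).trans ((norm_snd_le p).trans hp)
  let l : Shape lam.card := ⟨lam, rfl⟩
  have hf : (dimV lam : ℝ) ≤ N ^ lam.card := by exact_mod_cast dimV_le (l := l) h
  have hs : ‖MvPolynomial.eval p.2 (schur N lam)‖ ≤
      N ^ lam.card * (N ^ lam.card * R ^ lam.card) :=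
    (norm_eval_schur_le l hc).trans (by gcongr)
  have hd : (1 : ℝ) ≤ lam.card.factorial := by exact_mod_cast lam.card.factorial_pos
  rw [bgwDiagramTerm]
  simp only [norm_mul]
  rw [norm_div, norm_mul, norm_pow, norm_pow, RCLike.norm_natCast, RCLike.norm_natCast]
  -- One of the two factorials is given up; the count is again R³N⁶, so one majorant serves both
  -- series.
  calc _ ≤ R ^ (2 * lam.card) / (1 * lam.card.factorial) * N ^ (2 * lam.card) *
        (N ^ lam.card * (N ^ lam.card * R ^ lam.card) * (N ^ lam.card) ^ 2) := by
        gcongr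
        refine (norm_div_dimW_le _ h).trans ?_
        rw [norm_pow, RCLike.norm_natCast]
        gcongr
    _ = _ := by rw [mul_pow, ← pow_mul, ← pow_mul]; ring

theorem majorant_nonneg {R : ℝ} (hR : 0 ≤ R) (lam : YoungDiagram) : 0 ≤ majorant N R lam := by
  rw [majorant]
  split_ifs
  · exact le_rfl
  · positivity

theorem sum_majorant_le {R : ℝ} (hR : 0 ≤ R) (N d : ℕ) :
    ∑ l : Shape d, majorant N R l.1 ≤ (N * (R ^ 3 * N ^ 6)) ^ d / d.factorial := by
  have h1 : ∀ l : Shape d, majorant N R l.1 =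
      if dimW N l.1 ≠ 0 then (R ^ 3 * N ^ 6) ^ d / d.factorial else 0 := fun l => by
    rw [majorant, l.2]
    split_ifs <;> simp_all
  rw [Finset.sum_congr rfl fun l _ => h1 l, ← Finset.sum_filter, Finset.sum_const, nsmul_eq_mul,
    mul_pow (N : ℝ), mul_div_assoc]
  gcongr
  exact_mod_cast card_shape_dimW_ne_zero_le N d

/-- Grouped by size, at most N^d diagrams contribute in degree d, which leaves an exponential
series. -/
theorem summable_majorant {R : ℝ} (hR : 0 ≤ R) (N : ℕ) : Summable (majorant N R) := by
  rw [← (Equiv.sigmaFiberEquiv YoungDiagram.card).summable_iff]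
  refine (summable_sigma_of_nonneg fun x => majorant_nonneg hR _).2
    ⟨fun d => summable_of_hasFiniteSupport (Set.toFinite _), ?_⟩
  refine Summable.of_nonneg_of_le (fun d => tsum_nonneg fun _ => majorant_nonneg hR _)
    (fun d => ?_) (Real.summable_pow_div_factorial (N * (R ^ 3 * N ^ 6)))
  rw [tsum_fintype]
  exact sum_majorant_le hR N d

theorem sum_diagrams_norm_le {R : ℝ} {F : YoungDiagram → ℂ} (hR : 0 ≤ R)
    (hF : ∀ lam, ‖F lam‖ ≤ majorant N R lam) (d : ℕ) :
    ‖∑ lam ∈ diagrams N d, F lam‖ ≤ (N * (R ^ 3 * N ^ 6)) ^ d / d.factorial := by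
  refine (norm_sum_le _ _).trans ((Finset.sum_le_sum fun lam _ => hF lam).trans ?_)
  rw [sum_diagrams_eq_sum_shape (majorant N R) fun l h => by rw [majorant, if_pos h]]
  exact sum_majorant_le hR N d

/-! ### Convergence -/

/-- The Weierstrass test on a ball containing the compact set; `Q` gives the growth rate in terms of
the radius. -/
theorem seriesConverges_of_bound {X : Type*} [NormedAddCommGroup X] {f : ℕ → X → ℂ} (Q : ℝ → ℝ)
    (hf : ∀ R p d, ‖p‖ ≤ R → ‖f d p‖ ≤ Q R ^ d / d.factorial) : SeriesConverges f := by
  have hs : ∀ R, Summable fun d : ℕ => Q R ^ (d + 1) / (d + 1).factorial := fun R =>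
    (summable_nat_add_iff 1).2 (Real.summable_pow_div_factorial (Q R))
  refine ⟨fun p => Summable.of_nonneg_of_le (fun _ => norm_nonneg _)
    (fun d => hf ‖p‖ p (d + 1) le_rfl) (hs _), fun K hK => ?_⟩
  obtain ⟨R, hR⟩ := hK.isBounded.exists_norm_le
  have h := tendstoUniformlyOn_tsum_nat (f := fun d p => f (d + 1) p) (hs R)
    (s := K) fun d p hp => hf R p (d + 1) (hR p hp)
  rw [Metric.tendstoUniformlyOn_iff] at h ⊢
  intro ε hε
  filter_upwards [h ε hε] with n hn p hp
  rw [dist_add_left]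
  exact hn p hp

theorem summableUniformlyOn_of_majorant {X : Type*} [NormedAddCommGroup X]
    {F : YoungDiagram → X → ℂ}
    (hF : ∀ R lam p, ‖p‖ ≤ R → ‖F lam p‖ ≤ majorant N R lam) {K : Set X} (hK : IsCompact K) :
    SummableUniformlyOn (fun (lam : {lam : YoungDiagram // numRows lam ≤ N}) p => ‖F lam p‖) K := by
  obtain ⟨R, hR0, hR⟩ := hK.isBounded.exists_pos_norm_le
  refine (HasSumUniformlyOn.of_norm_le_summable
    ((summable_majorant hR0.le N).subtype _) fun lam p hp => ?_).summableUniformlyOn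
  rw [norm_norm]
  exact hF R lam p (hR p hp)

/-! ### The expansions -/

theorem hasSum_integral_pow {X : U N → ℂ} (hX : Continuous X) :
    HasSum (fun n : ℕ => ∫ u, X u ^ n / n.factorial ∂(haarU N))
      (∫ u, Complex.exp (X u) ∂(haarU N)) := by
  obtain ⟨C, hC⟩ := (isCompact_univ (X := U N)).exists_bound_of_continuousOn hX.continuousOn
  refine hasSum_integral_of_dominated_convergence (fun n _ => C ^ n / n.factorial) ?_ ?_ ?_ ?_ ?_
  · intro n
    exact (integrable_of_continuous ((hX.pow n).div_const _)).aestronglyMeasurable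
  · intro n
    refine Filter.Eventually.of_forall fun u => ?_
    rw [norm_div, norm_pow, RCLike.norm_natCast]
    have := hC u (Set.mem_univ u)
    gcongr
  · exact Filter.Eventually.of_forall fun u => Real.summable_pow_div_factorial C
  · exact integrable_const _
  · refine Filter.Eventually.of_forall fun u => ?_
    rw [Complex.exp_eq_exp_ℂ]
    exact NormedSpace.expSeries_div_hasSum_exp (X u)

theorem hasSum_integral_pow_mul_pow {X Y : U N → ℂ} (hX : Continuous X) (hY : Continuous Y) :
    HasSum (fun n : ℕ × ℕ => ∫ u, X u ^ n.1 / n.1.factorial * (Y u ^ n.2 / n.2.factorial) ∂(haarU N))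
      (∫ u, Complex.exp (X u + Y u) ∂(haarU N)) := by
  obtain ⟨C, hC⟩ := (isCompact_univ (X := U N)).exists_bound_of_continuousOn hX.continuousOn
  obtain ⟨C', hC'⟩ := (isCompact_univ (X := U N)).exists_bound_of_continuousOn hY.continuousOn
  have hC0 : 0 ≤ C := (norm_nonneg _).trans (hC 1 (Set.mem_univ 1))
  have hC0' : 0 ≤ C' := (norm_nonneg _).trans (hC' 1 (Set.mem_univ 1))
  refine hasSum_integral_of_dominated_convergence
    (fun n _ => C ^ n.1 / n.1.factorial * (C' ^ n.2 / n.2.factorial)) ?_ ?_ ?_ ?_ ?_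
  · intro n
    exact (integrable_of_continuous
      (((hX.pow _).div_const _).mul ((hY.pow _).div_const _))).aestronglyMeasurable
  · intro n
    refine Filter.Eventually.of_forall fun u => ?_
    rw [norm_mul, norm_div, norm_pow, RCLike.norm_natCast, norm_div, norm_pow, RCLike.norm_natCast]
    have := hC u (Set.mem_univ u)
    have := hC' u (Set.mem_univ u)
    gcongr
  · exact Filter.Eventually.of_forall fun u =>
      (Real.summable_pow_div_factorial C).mul_of_nonneg (Real.summable_pow_div_factorial C')
        (fun n => by positivity) (fun n => by positivity)
  · exact integrable_const _
  · refine Filter.Eventually.of_forall fun u => ?_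
    rw [Complex.exp_add, Complex.exp_eq_exp_ℂ]
    have h : ∀ x : ℂ, Summable fun n : ℕ => ‖x ^ n / (n.factorial : ℂ)‖ := fun x =>
      NormedSpace.norm_expSeries_div_summable x
    have hXu := NormedSpace.expSeries_div_hasSum_exp (𝔸 := ℂ) (X u)
    have hYu := NormedSpace.expSeries_div_hasSum_exp (𝔸 := ℂ) (Y u)
    have hsum := summable_mul_of_summable_norm (h (X u)) (h (Y u))
    exact HasSum.mul (f := fun n : ℕ => X u ^ n / (n.factorial : ℂ))
      (g := fun n : ℕ => Y u ^ n / (n.factorial : ℂ)) hXu hYu hsum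

theorem continuous_coe_U : Continuous fun u : U N => (u : Matrix (Fin N) (Fin N) ℂ) :=
  continuous_subtype_val

theorem continuous_coe_inv_U :
    Continuous fun u : U N => ((u⁻¹ : U N) : Matrix (Fin N) (Fin N) ℂ) :=
  continuous_subtype_val.comp continuous_inv

theorem eq_one_add_tsum {f : ℕ → ℂ} {s : ℂ} (hf : HasSum f s) (h0 : f 0 = 1) :
    s = 1 + ∑' d, f (d + 1) := by
  rw [← hf.tsum_eq, hf.summable.tsum_eq_zero_add, h0]

theorem hciz_eq (z : ℂ) {A B : Matrix (Fin N) (Fin N) ℂ} {a b : Fin N → ℂ}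
    (ha : AreEigenvalues A a) (hb : AreEigenvalues B b) :
    hciz N z A B = 1 + ∑' d : ℕ, hcizTerm N (d + 1) (z, a, b) := by
  let X : U N → ℂ := fun u => (A * (u : Matrix (Fin N) (Fin N) ℂ) * B *
    ((u⁻¹ : U N) : Matrix (Fin N) (Fin N) ℂ)).trace
  have hX : Continuous X := Continuous.matrix_trace (((continuous_const.matrix_mul
    continuous_coe_U).matrix_mul continuous_const).matrix_mul continuous_coe_inv_U)
  have hterm : ∀ d : ℕ, ∫ u, (z * N * X u) ^ d / d.factorial ∂(haarU N) =
      hcizTerm N d (z, a, b) := fun d => by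
    have h1 : ∀ u, (z * N * X u) ^ d / (d.factorial : ℂ) =
        z ^ d / (d.factorial : ℂ) * (N : ℂ) ^ d * X u ^ d := fun u => by
      rw [mul_pow, mul_pow]; ring
    simp only [h1]
    rw [integral_const_mul, integral_trace_conj_pow ha hb, hcizTerm, sum_diagrams_eq_sum_shape]
    intro l h
    simp [h]
  have h := hasSum_integral_pow (X := fun u => z * N * X u) (continuous_const.mul hX)
  have h0 : ∫ u, (z * N * X u) ^ 0 / Nat.factorial 0 ∂(haarU N) = 1 := by simp
  have h1 := eq_one_add_tsum h h0
  simp only [hterm] at h1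
  exact h1

/-! ### Vanishing of the moments of unequal degree, and the second expansion -/

theorem exists_unit_pow_ne {p q : ℕ} (hpq : p ≠ q) :
    ∃ ζ : ℂ, star ζ * ζ = 1 ∧ ζ ^ p * (star ζ) ^ q = -1 := by
  have hne : ((p : ℂ) - q) ≠ 0 := sub_ne_zero.2 (by exact_mod_cast hpq)
  -- Chosen so that the phase e^{iθ(p-q)} equals -1.
  let θ : ℝ := Real.pi / ((p : ℝ) - q)
  have hstar : star (Complex.exp (θ * Complex.I)) = Complex.exp (-(θ * Complex.I)) := by
    rw [← starRingEnd_apply, ← Complex.exp_conj]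
    simp
  refine ⟨Complex.exp (θ * Complex.I), ?_, ?_⟩
  · rw [hstar, ← Complex.exp_add]
    simp
  · rw [hstar, ← Complex.exp_nat_mul, ← Complex.exp_nat_mul, ← Complex.exp_add,
      ← Complex.exp_pi_mul_I]
    congr 1
    simp only [θ]
    push_cast
    field_simp
    ring

/-- Translation by the scalar unitary ζ multiplies the integrand by -1, while the integral is
invariant. -/
theorem integral_trace_pow_mul_trace_pow_of_ne (A B : Matrix (Fin N) (Fin N) ℂ) {p q : ℕ}
    (hpq : p ≠ q) :
    ∫ u : U N, (A * (u : Matrix (Fin N) (Fin N) ℂ)).trace ^ p *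
      (B * ((u⁻¹ : U N) : Matrix (Fin N) (Fin N) ℂ)).trace ^ q ∂(haarU N) = 0 := by
  obtain ⟨ζ, hζ, hpow⟩ := exists_unit_pow_ne hpq
  have hv : ζ • (1 : Matrix (Fin N) (Fin N) ℂ) ∈ Matrix.unitaryGroup (Fin N) ℂ := by
    rw [Matrix.mem_unitaryGroup_iff', star_smul, star_one, smul_mul_smul_comm, hζ, one_mul,
      one_smul]
  let v : U N := ⟨_, hv⟩
  have h := integral_mul_left_eq_self (μ := haarU N)
    (fun u : U N => (A * (u : Matrix (Fin N) (Fin N) ℂ)).trace ^ p *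
      (B * ((u⁻¹ : U N) : Matrix (Fin N) (Fin N) ℂ)).trace ^ q) v
  have h1 : ∀ u : U N, ((v * u : U N) : Matrix (Fin N) (Fin N) ℂ) = ζ • u.1 := fun u => by
    change (ζ • (1 : Matrix (Fin N) (Fin N) ℂ)) * u.1 = _
    rw [smul_mul_assoc, one_mul]
  have h2 : ∀ u : U N, (((v * u)⁻¹ : U N) : Matrix (Fin N) (Fin N) ℂ) =
      star ζ • ((u⁻¹ : U N) : Matrix (Fin N) (Fin N) ℂ) := fun u => by
    change star ((v * u : U N) : Matrix (Fin N) (Fin N) ℂ) = star ζ • star u.1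
    rw [h1, star_smul]
  have h3 : ∀ u : U N, (A * ((v * u : U N) : Matrix (Fin N) (Fin N) ℂ)).trace ^ p *
      (B * (((v * u)⁻¹ : U N) : Matrix (Fin N) (Fin N) ℂ)).trace ^ q =
      -((A * (u : Matrix (Fin N) (Fin N) ℂ)).trace ^ p *
      (B * ((u⁻¹ : U N) : Matrix (Fin N) (Fin N) ℂ)).trace ^ q) := fun u => by
    rw [h1, h2, mul_smul_comm, mul_smul_comm, Matrix.trace_smul, Matrix.trace_smul, smul_eq_mul,
      smul_eq_mul, mul_pow, mul_pow, mul_mul_mul_comm, hpow, neg_one_mul]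
  simp only [h3, integral_neg] at h
  exact self_eq_neg.1 h.symm

theorem bgw_eq (z : ℂ) {A B : Matrix (Fin N) (Fin N) ℂ} {c : Fin N → ℂ}
    (hc : AreEigenvalues (A * B) c) :
    bgw N z A B = 1 + ∑' d : ℕ, bgwTerm N (d + 1) (z, c) := by
  let X : U N → ℂ := fun u => (A * (u : Matrix (Fin N) (Fin N) ℂ)).trace
  let Y : U N → ℂ := fun u => (B * ((u⁻¹ : U N) : Matrix (Fin N) (Fin N) ℂ)).trace
  have hX : Continuous X := Continuous.matrix_trace (continuous_const.matrix_mul continuous_coe_U)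
  have hY : Continuous Y :=
    Continuous.matrix_trace (continuous_const.matrix_mul continuous_coe_inv_U)
  have hterm : ∀ n : ℕ × ℕ, ∫ u, (z * N * X u) ^ n.1 / n.1.factorial *
      ((z * N * Y u) ^ n.2 / n.2.factorial) ∂(haarU N) =
      (z * N) ^ n.1 / n.1.factorial * ((z * N) ^ n.2 / n.2.factorial) *
        ∫ u, X u ^ n.1 * Y u ^ n.2 ∂(haarU N) := fun n => by
    rw [← integral_const_mul]
    congr 1
    funext u
    rw [mul_pow _ (X u), mul_pow _ (Y u)]
    ring
  have h := hasSum_integral_pow_mul_pow (X := fun u => z * N * X u) (Y := fun u => z * N * Y u)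
    (continuous_const.mul hX) (continuous_const.mul hY)
  simp only [hterm] at h
  -- Off-diagonal terms of the double series vanish, so it restricts to the diagonal; this is why
  -- only even powers of z occur.
  have hinj : Function.Injective fun d : ℕ => (d, d) := fun d d' h => congrArg Prod.fst h
  rw [← hinj.hasSum_iff] at h
  swap
  · rintro ⟨p, q⟩ hpq
    have hne : p ≠ q := fun e => hpq ⟨p, by rw [e]⟩
    simp only [X, Y]
    rw [integral_trace_pow_mul_trace_pow_of_ne A B hne, mul_zero]
  have hdiag : ∀ d : ℕ, (z * N) ^ d / (d.factorial : ℂ) * ((z * N) ^ d / d.factorial) *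
      ∫ u, X u ^ d * Y u ^ d ∂(haarU N) = bgwTerm N d (z, c) := fun d => by
    simp only [X, Y]
    rw [integral_trace_pow_mul_trace_pow hc, bgwTerm, sum_diagrams_eq_sum_shape]
    · simp only [mul_pow, two_mul, pow_add]
      ring
    · intro l h
      simp [h]
  have h0 : (z * N) ^ 0 / (Nat.factorial 0 : ℂ) * ((z * N) ^ 0 / Nat.factorial 0) *
      ∫ u, X u ^ 0 * Y u ^ 0 ∂(haarU N) = 1 := by simp
  have h1 := eq_one_add_tsum h h0
  simp only [Function.comp_apply, hdiag] at h1
  rw [← h1, bgw]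
  congr 1
  funext u
  rw [Matrix.trace_add, mul_add]

end CharExp

end

theorem theorem2p1 (N : ℕ) :
    -- the HCIZ expansion
    (∀ (z : ℂ) (A B : Matrix (Fin N) (Fin N) ℂ) (a b : Fin N → ℂ),
      CharExp.AreEigenvalues A a → CharExp.AreEigenvalues B b →
        CharExp.hciz N z A B = 1 + ∑' d : ℕ, CharExp.hcizTerm N (d + 1) (z, a, b)) ∧
    -- the BGW expansion
    (∀ (z : ℂ) (A B : Matrix (Fin N) (Fin N) ℂ) (c : Fin N → ℂ),
      CharExp.AreEigenvalues (A * B) c →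
        CharExp.bgw N z A B = 1 + ∑' d : ℕ, CharExp.bgwTerm N (d + 1) (z, c)) ∧
    -- absolute convergence, uniform on compact sets, of both series
    CharExp.SeriesConverges (CharExp.hcizTerm N) ∧
    CharExp.SeriesConverges (CharExp.bgwTerm N) ∧
    -- the same when the series are read as series over Young diagrams with at most `N` rows
    (∀ K : Set (ℂ × (Fin N → ℂ) × (Fin N → ℂ)), IsCompact K →
      SummableUniformlyOn (fun (lam : {lam : YoungDiagram // CharExp.numRows lam ≤ N}) p =>
        ‖CharExp.hcizDiagramTerm N lam p‖) K) ∧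
    (∀ K : Set (ℂ × (Fin N → ℂ)), IsCompact K →
      SummableUniformlyOn (fun (lam : {lam : YoungDiagram // CharExp.numRows lam ≤ N}) p =>
        ‖CharExp.bgwDiagramTerm N lam p‖) K) := by
  refine ⟨fun z A B a b ha hb => CharExp.hciz_eq z ha hb, fun z A B c hc => CharExp.bgw_eq z hc,
    ?_, ?_, fun K hK => ?_, fun K hK => ?_⟩
  · refine CharExp.seriesConverges_of_bound (fun R => N * (R ^ 3 * N ^ 6)) fun R p d hp => ?_
    rw [CharExp.hcizTerm_eq_sum]
    exact CharExp.sum_diagrams_norm_le ((norm_nonneg p).trans hp)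
      (fun lam => CharExp.norm_hcizDiagramTerm_le lam hp) d
  · refine CharExp.seriesConverges_of_bound (fun R => N * (R ^ 3 * N ^ 6)) fun R p d hp => ?_
    rw [CharExp.bgwTerm_eq_sum]
    exact CharExp.sum_diagrams_norm_le ((norm_nonneg p).trans hp)
      (fun lam => CharExp.norm_bgwDiagramTerm_le lam hp) d
  · exact CharExp.summableUniformlyOn_of_majorant
      (fun R lam p hp => CharExp.norm_hcizDiagramTerm_le lam hp) hK
  · exact CharExp.summableUniformlyOn_of_majorant
      (fun R lam p hp => CharExp.norm_bgwDiagramTerm_le lam hp) hK
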